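/- Let $\Bbbk$ be a field of characteristic $p>0$, and let $G\subset\mathrm{PGL}_2(\Bbbk)$ be a finite subgroup. Denote by $G_{(p)}$ a Sylow $p$-subgroup of $G$. Then $G$ contains a characteristic cyclic subgroup of order coprime to $p$ and index at most $J_p(\mathbb P^1)\cdot |G_{(p)}|^3$, where $$ J_p(\mathbb P^1)=\begin{cases}60,&\text{if } p\geqslant 7,\\ 24,&\text{if } p=5,\\ 4,&\text{if } p=3,\\ 1,&\text{if } p=2.\end{cases} $$ Moreover, if $p=5$ and $G$ is not isomorphic to any of the groups $\mathfrak S_4$, $\mathfrak A_4$, and $\boldsymbol\mu_2^2$ (the symmetric and the alternating group of degree $4$, and the product of two cyclic groups of order $2$), then $G$ contains a characteristic cyclic subgroup of order coprime to $5$ and index at most $2\cdot|G_{(5)}|^3$; if $p=5$ and $G$ is isomorphic to one of these three groups, then $G$ contains a characteristic abelian subgroup of order $4$ and index at most $6=6\cdot|G_{(5)}|^3$. If $p=3$ and $G\not\cong\boldsymbol\mu_2^2$, then $G$ contains a characteristic cyclic subgroup of order coprime to $3$ and index at most $\frac{20}{9}\cdot|G_{(3)}|^3$; if $p=3$ and $G\cong\boldsymbol\mu_2^2$,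 then $G$ is abelian. -/

import Mathlib

/-- The constant `J_p(ℙ¹)` for a prime number `p`. -/
def jordanConstP1 (p : ℕ) : ℚ :=
  if 7 ≤ p then 60
  else if p = 5 then 24
  else if p = 3 then 4
  else 1

/-- The group `G` contains a characteristic cyclic subgroup of order coprime to `p` and of index
at most `J * |G_(p)| ^ 3`, where `G_(p)` is a Sylow `p`-subgroup of `G`. (All Sylow subgroups
of a finite group have the same order, and there is at least one.) -/
def HasCharCyclicSubgroupOfBound (p : ℕ) (G : Type*) [Group G] (J : ℚ) : Prop :=
  ∃ C : Subgroup G, C.Characteristic ∧ IsCyclic C ∧ (Nat.card C).Coprime p ∧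
    ∀ P : Sylow p G, (C.index : ℚ) ≤ J * (Nat.card P : ℚ) ^ 3

/-- `G` is isomorphic to `μ₂ × μ₂`, the product of two cyclic groups of order two. -/
def IsoMuTwoSq (G : Type*) [Group G] : Prop :=
  Nonempty (G ≃* Multiplicative (ZMod 2) × Multiplicative (ZMod 2))

/-- `G` is isomorphic to the symmetric group on four letters, to the alternating group on four
letters, or to `μ₂ × μ₂`. -/
def IsoSymAltFourOrMuTwoSq (G : Type*) [Group G] : Prop :=
  Nonempty (G ≃* Equiv.Perm (Fin 4)) ∨ Nonempty (G ≃* alternatingGroup (Fin 4)) ∨ IsoMuTwoSq G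

/-! After extension of scalars, `G` acts faithfully on the projective line over the algebraic
closure. Every element has a fixed point, and a point stabilizer consists of affine maps `z ↦ a z +
b`. The translations in it form its unipotent subgroup, of order `u`; their nontrivial elements fix
one point, and all other elements of the stabilizer fix exactly two. `IsProjectiveLineAction`
records just these facts, and everything else is deduced from them.

Counting fixed points of nontrivial elements, unipotent ones twice, gives a class equation
(`exists_representatives`): the sum of `1 + (u - 2) / s` over the nonregular orbits is `2 - 2 /
|G|`, where `s` is the stabilizer order.

If `p ∤ |G|`, then `u = 1` everywhere and the equation has the classical solutions. Two orbits force
`G` to be cyclic. Three orbits have stabilizer orders `(2,2,n)`, `(2,3,3)` or `(2,3,4)`, or else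
`|G| = 60`. For `n ≥ 3` the first type has a characteristic cyclic subgroup of index 2, for `n = 2`
it is the Klein group; the next two are the alternating and symmetric groups of degree 4. In the
last case the trivial subgroup is good enough, so the group need not be identified; the case cannot
occur for `p ≤ 5`.

If `p ∣ |G|`, the nontrivial unipotent subgroups are Sylow subgroups, of order `q`, and their fixed
points form one orbit, of length `1 + q t`, with stabilizers of order `q e`, `e ≤ q - 1`. At most
one further nonregular orbit exists, and arithmetic (`modular_class_equation_bound`) gives `|G| ≤ q
^ 3` with two exceptions: `q = 3`, `|G| = 60`, which produces the constant `20 / 9`, and `q = 2`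
with a cyclic subgroup of index 2 and odd order. -/

open MulAction Matrix Matrix.ProjGenLinGroup
open scoped MatrixGroups OnePoint

/-! ### Actions modelled on the projective line -/

/-- An action of a group on a set that looks like the action of a group of Möbius transformations
on the projective line over an algebraically closed field `K` of characteristic `p`: every element
has a fixed point, and every point stabilizer has a character to `Kˣ` whose kernel consists of
elements of order dividing `p` without further fixed points, while the other elements of the
stabilizer have exactly one further fixed point. -/
structure IsProjectiveLineAction (p : ℕ) (K G X : Type*) [Field K] [Group G] [MulAction G X] :
    Prop where
  exists_fixed (g : G) : ∃ x : X, g • x = x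
  exists_character (x : X) : ∃ χ : stabilizer G x →* Kˣ,
    (∀ g, χ g = 1 → (g : G) ^ p = 1 ∧ (g ≠ 1 → ∀ y : X, (g : G) • y = y → y = x)) ∧
    (∀ g, χ g ≠ 1 → ∃ y : X, y ≠ x ∧ ∀ z : X, (g : G) • z = z ↔ z = x ∨ z = y)

/-- The character is the linear coefficient `a`. It is well defined and multiplicative because an
affine map is determined by its values at `0` and `1`. -/
theorem isProjectiveLineAction_of_affine {p : ℕ} {K G X : Type*} [Field K] [CharP K p]
    [Group G] [MulAction G X] (faithful : ∀ g : G, (∀ x : X, g • x = x) → g = 1)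
    (fixed : ∀ g : G, ∃ x : X, g • x = x)
    (affine : ∀ x : X, ∃ σ : OnePoint K ≃ X, σ ∞ = x ∧ ∀ g : G, g • x = x →
      ∃ (a : Kˣ) (b : K), ∀ z : K, g • σ z = σ (a * z + b : K)) :
    IsProjectiveLineAction p K G X := by
  refine ⟨fixed, fun x => ?_⟩
  obtain ⟨σ, rfl, hσ⟩ := affine x
  choose! a b hab using hσ
  have uniq : ∀ g : G, g • σ ∞ = σ ∞ → ∀ (c d : K), (∀ z : K, g • σ z = σ (c * z + d : K)) →
      (a g : K) = c ∧ b g = d := by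
    intro g hg c d h
    have h0 := (hab g hg 0).symm.trans (h 0)
    have h1 := (hab g hg 1).symm.trans (h 1)
    simp only [EmbeddingLike.apply_eq_iff_eq, OnePoint.coe_eq_coe] at h0 h1
    simp only [mul_zero, zero_add, mul_one] at h0 h1
    exact ⟨by rw [h0] at h1; exact add_right_cancel h1, h0⟩
  have infty_or : ∀ y : X, y = σ ∞ ∨ ∃ z : K, y = σ z := by
    intro y
    obtain ⟨w, rfl⟩ := σ.surjective y
    cases w with
    | infty => exact Or.inl rfl
    | coe z => exact Or.inr ⟨z, rfl⟩
  let χ : stabilizer G (σ ∞) →* Kˣ :=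
    { toFun := fun g => a g
      map_one' := Units.ext (uniq 1 (one_smul _ _) 1 0 (by simp)).1
      map_mul' := fun g h => Units.ext <|
        (uniq (g * h) (g * h).2 (a g * a h) (a g * b h + b g) (fun z => by
          rw [mul_smul, hab h h.2, hab g g.2]; congr 2; ring)).1 }
  refine ⟨χ, fun g hg => ?_, fun g hg => ?_⟩
  · have ha : (a g : K) = 1 := congrArg Units.val hg
    have hact : ∀ z : K, (g : G) • σ z = σ (z + b g : K) := fun z => by
      rw [hab g g.2, ha, one_mul]
    constructor
    · have hpow : ∀ n : ℕ, ∀ z : K, (g : G) ^ n • σ z = σ (z + n * b g : K) := by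
        intro n
        induction n with
        | zero => simp
        | succ n ih => intro z; rw [pow_succ, mul_smul, hact, ih]; congr 2; push_cast; ring
      refine faithful _ fun y => ?_
      obtain rfl | ⟨z, rfl⟩ := infty_or y
      · exact (g ^ p).2
      · rw [hpow, CharP.cast_eq_zero, zero_mul, add_zero]
    · intro hne y hy
      obtain rfl | ⟨z, rfl⟩ := infty_or y
      · rfl
      · refine absurd (Subtype.ext (faithful _ fun w => ?_)) hne
        rw [hact] at hy
        simp only [EmbeddingLike.apply_eq_iff_eq, OnePoint.coe_eq_coe, add_eq_left] at hy
        obtain rfl | ⟨z, rfl⟩ := infty_or w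
        · exact g.2
        · rw [hact, hy, add_zero]
  · have ha : 1 - (a g : K) ≠ 0 := fun h => hg (Units.ext (sub_eq_zero.mp h).symm)
    -- The solution of `a z + b = z`.
    refine ⟨σ (b g / (1 - a g) : K), by simp, fun y => ?_⟩
    obtain rfl | ⟨z, rfl⟩ := infty_or y
    · exact iff_of_true g.2 (Or.inl rfl)
    · rw [hab g g.2]
      simp only [EmbeddingLike.apply_eq_iff_eq, OnePoint.coe_eq_coe, OnePoint.coe_ne_infty,
        false_or]
      rw [eq_div_iff ha]
      constructor <;> intro h <;> linear_combination -h

/-! ### Möbius transformations -/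

section Moebius

variable {K : Type*} [Field K] [DecidableEq K]

theorem OnePoint.scalar_smul (u : Kˣ) (x : OnePoint K) :
    GeneralLinearGroup.scalar (Fin 2) u • x = x := by
  cases x with
  | infty => simp [OnePoint.smul_infty_eq_ite]
  | coe z => simp [OnePoint.smul_some_eq_ite]

/-- The action of `PGL₂(K)` on the projective line by Möbius transformations. -/
instance OnePoint.instPGLAction : MulAction PGL(2, K) (OnePoint K) :=
  mulActionOfGL OnePoint.scalar_smul

theorem OnePoint.mk_smul (A : GL (Fin 2) K) (x : OnePoint K) :
    (ProjGenLinGroup.mk A : PGL(2, K)) • x = A • x := rfl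

theorem OnePoint.exists_fixed [IsAlgClosed K] (g : PGL(2, K)) : ∃ x : OnePoint K, g • x = x := by
  induction g using ProjGenLinGroup.induction_on with | mk A =>
  by_cases h : A 1 0 = 0
  · exact ⟨∞, OnePoint.smul_infty_eq_self_iff.mpr h⟩
  -- The finite fixed points are the roots of `c z² + (d - a) z - b`, a genuine quadratic when `∞`
  -- is not fixed.
  · obtain ⟨z, hz⟩ := IsAlgClosed.exists_root
      (Polynomial.C (A 1 0) * Polynomial.X ^ 2 + Polynomial.C (A 1 1 - A 0 0) * Polynomial.X
        + Polynomial.C (-A 0 1)) (by rw [Polynomial.degree_quadratic h]; decide)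
    refine ⟨z, ?_⟩
    rw [OnePoint.mk_smul, ← GeneralLinearGroup.fixpointPolynomial_aeval_eq_zero_iff]
    simp only [Polynomial.IsRoot, Polynomial.eval_add, Polynomial.eval_mul, Polynomial.eval_C,
      Polynomial.eval_pow, Polynomial.eval_X] at hz
    simp only [GeneralLinearGroup.fixpointPolynomial, map_sub, map_mul, map_add,
      Polynomial.aeval_X_pow, Polynomial.aeval_C, Polynomial.aeval_X,
      Algebra.algebraMap_self_apply]
    linear_combination hz

theorem OnePoint.eq_one_of_forall_smul (g : PGL(2, K)) (h : ∀ x : OnePoint K, g • x = x) :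
    g = 1 := by
  induction g using ProjGenLinGroup.induction_on with | mk A =>
  simp only [OnePoint.mk_smul] at h
  have h10 : A 1 0 = 0 := OnePoint.smul_infty_eq_self_iff.mp (h ∞)
  have hdet := A.det_ne_zero
  rw [det_fin_two, h10, mul_zero, sub_zero] at hdet
  have h11 : A 1 1 ≠ 0 := right_ne_zero_of_mul hdet
  have hz : ∀ z : K, A 0 0 * z + A 0 1 = z * A 1 1 := by
    intro z
    have := h (z : OnePoint K)
    rw [OnePoint.smul_some_eq_ite, h10, zero_mul, zero_add, if_neg h11, OnePoint.coe_eq_coe,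
      div_eq_iff h11] at this
    exact this
  have h01 : A 0 1 = 0 := by simpa using hz 0
  have h00 : A 0 0 = A 1 1 := by simpa [h01] using hz 1
  rw [ProjGenLinGroup.mk_eq_one, GeneralLinearGroup.center_eq_range_scalar]
  refine ⟨Units.mk0 _ h11, Units.ext (Matrix.ext fun i j => ?_)⟩
  fin_cases i <;> fin_cases j <;> simp [h10, h01, h00]

theorem OnePoint.exists_smul_infty (x : OnePoint K) :
    ∃ g : PGL(2, K), g • (∞ : OnePoint K) = x := by
  cases x with
  | infty => exact ⟨1, one_smul _ _⟩
  | coe z =>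
    refine ⟨ProjGenLinGroup.mk (GeneralLinearGroup.mkOfDetNeZero !![z, 1; 1, 0] (by simp)), ?_⟩
    rw [OnePoint.mk_smul, OnePoint.smul_infty_eq_ite]
    simp [GeneralLinearGroup.mkOfDetNeZero]

theorem OnePoint.exists_affine (g : PGL(2, K)) (h : g • (∞ : OnePoint K) = ∞) :
    ∃ (a : Kˣ) (b : K), ∀ z : K, g • (z : OnePoint K) = (a * z + b : K) := by
  induction g using ProjGenLinGroup.induction_on with | mk A =>
  have h10 : A 1 0 = 0 := OnePoint.smul_infty_eq_self_iff.mp h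
  have hdet := A.det_ne_zero
  rw [det_fin_two, h10, mul_zero, sub_zero] at hdet
  have h11 : A 1 1 ≠ 0 := right_ne_zero_of_mul hdet
  refine ⟨Units.mk0 (A 0 0 / A 1 1) (div_ne_zero (left_ne_zero_of_mul hdet) h11),
    A 0 1 / A 1 1, fun z => ?_⟩
  rw [OnePoint.mk_smul, OnePoint.smul_some_eq_ite, h10, zero_mul, zero_add, if_neg h11,
    OnePoint.coe_eq_coe, Units.val_mk0]
  field_simp

end Moebius

/-! ### Passage to the algebraic closure -/

theorem Matrix.ProjGenLinGroup.map_injective {k K : Type*} [Field k] [Field K] (f : k →+* K) :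
    Function.Injective (ProjGenLinGroup.map (n := Fin 2) f) := by
  rw [injective_iff_map_eq_one]
  intro g hg
  induction g using ProjGenLinGroup.induction_on with | mk A =>
  rw [ProjGenLinGroup.map_mk, ProjGenLinGroup.mk_eq_one,
    GeneralLinearGroup.center_eq_range_scalar] at hg
  obtain ⟨u, hu⟩ := hg
  have hu' : ∀ i j, scalar (Fin 2) (u : K) i j = f (A i j) := fun i j => by
    have := congrArg (fun B : GL (Fin 2) K => B i j) hu
    simpa using this
  have h10 : A 1 0 = 0 := f.injective (by simpa using (hu' 1 0).symm)
  have h01 : A 0 1 = 0 := f.injective (by simpa using (hu' 0 1).symm)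
  have h00 : A 0 0 = A 1 1 := f.injective (by
    have h0 := hu' 0 0
    have h1 := hu' 1 1
    simp only [scalar_apply, diagonal_apply_eq] at h0 h1
    exact h0.symm.trans h1)
  have hdet := A.det_ne_zero
  rw [det_fin_two, h10, mul_zero, sub_zero] at hdet
  rw [ProjGenLinGroup.mk_eq_one, GeneralLinearGroup.center_eq_range_scalar]
  refine ⟨Units.mk0 _ (right_ne_zero_of_mul hdet), Units.ext (Matrix.ext fun i j => ?_)⟩
  fin_cases i <;> fin_cases j <;> simp [h10, h01, h00]

theorem exists_isProjectiveLineAction {k : Type*} [Field k] (p : ℕ) [CharP k p]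
    (G : Subgroup (ProjGenLinGroup (Fin 2) k)) :
    ∃ _ : MulAction G (OnePoint (AlgebraicClosure k)),
      IsProjectiveLineAction p (AlgebraicClosure k) G (OnePoint (AlgebraicClosure k)) := by
  classical
  let f := algebraMap k (AlgebraicClosure k)
  have : CharP (AlgebraicClosure k) p := charP_of_injective_algebraMap f.injective p
  let φ : G →* PGL(2, AlgebraicClosure k) := (ProjGenLinGroup.map f).comp G.subtype
  have hφ : Function.Injective φ := (map_injective f).comp G.subtype_injective
  refine ⟨MulAction.compHom _ φ, ?_⟩
  let _ : MulAction G (OnePoint (AlgebraicClosure k)) := MulAction.compHom _ φ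
  have smul_eq : ∀ (g : G) (x : OnePoint (AlgebraicClosure k)), g • x = φ g • x :=
    fun _ _ => rfl
  refine isProjectiveLineAction_of_affine (fun g hg => hφ ?_)
    (fun g => OnePoint.exists_fixed (φ g)) fun x => ?_
  · rw [map_one]
    exact OnePoint.eq_one_of_forall_smul _ hg
  · obtain ⟨h, rfl⟩ := OnePoint.exists_smul_infty x
    refine ⟨MulAction.toPerm h, rfl, fun g hg => ?_⟩
    -- Conjugation by `h` moves the fixed point `x` to `∞`.
    obtain ⟨a, b, hab⟩ := OnePoint.exists_affine (h⁻¹ * φ g * h) (by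
      rw [mul_smul, mul_smul, inv_smul_eq_iff]; exact hg)
    refine ⟨a, b, fun z => ?_⟩
    rw [MulAction.toPerm_apply, MulAction.toPerm_apply, ← hab z, smul_eq, ← mul_smul, ← mul_smul]
    congr 1
    group

/-! ### Unipotent subgroups and fixed points -/

namespace IsProjectiveLineAction

/-- The subgroup of the stabilizer of `x` that consists of the identity and the elements without
fixed points other than `x`, provided that these form a subgroup. -/
noncomputable def unipotentSubgroup {K G X : Type*} [Field K] [Group G] [MulAction G X] {p : ℕ}
    (h : IsProjectiveLineAction p K G X) (x : X) : Subgroup G :=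
  (h.exists_character x).choose.ker.map (stabilizer G x).subtype

variable {p : ℕ} {K G X : Type*} [Field K] [Group G] [MulAction G X]

/-- This description does not involve the chosen character, which is what makes unipotent subgroups
compatible with conjugation. -/
theorem mem_unipotentSubgroup (h : IsProjectiveLineAction p K G X) {x : X} {g : G} :
    g ∈ h.unipotentSubgroup x ↔ g • x = x ∧ (g = 1 ∨ ∀ y : X, g • y = y → y = x) := by
  obtain ⟨h1, h2⟩ := (h.exists_character x).choose_spec
  rw [unipotentSubgroup, Subgroup.mem_map]
  constructor
  · rintro ⟨g, hg, rfl⟩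
    refine ⟨g.2, ?_⟩
    by_cases hg1 : g = 1
    · exact Or.inl (by simp [hg1])
    · exact Or.inr ((h1 g hg).2 hg1)
  · rintro ⟨hx, hg⟩
    refine ⟨⟨g, hx⟩, ?_, rfl⟩
    by_contra hne
    rw [MonoidHom.mem_ker] at hne
    obtain ⟨y, hy, hz⟩ := h2 _ hne
    obtain rfl | hg := hg
    · exact hne (map_one _)
    · exact hy (hg y ((hz y).mpr (Or.inr rfl)))

theorem unipotentSubgroup_le (h : IsProjectiveLineAction p K G X) (x : X) :
    h.unipotentSubgroup x ≤ stabilizer G x := fun _ hg => (h.mem_unipotentSubgroup.mp hg).1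

theorem eq_of_mem_unipotentSubgroup (h : IsProjectiveLineAction p K G X) {x y : X} {g : G}
    (hg : g ∈ h.unipotentSubgroup x) (hg1 : g ≠ 1) (hy : g • y = y) : y = x :=
  ((h.mem_unipotentSubgroup.mp hg).2.resolve_left hg1) y hy

theorem pow_eq_one_of_mem_unipotentSubgroup (h : IsProjectiveLineAction p K G X) {x : X} {g : G}
    (hg : g ∈ h.unipotentSubgroup x) : g ^ p = 1 := by
  obtain ⟨g, hg, rfl⟩ := hg
  exact ((h.exists_character x).choose_spec.1 g hg).1

theorem exists_other_fixed (h : IsProjectiveLineAction p K G X) {x : X} {g : G}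
    (hx : g • x = x) (hg : g ∉ h.unipotentSubgroup x) :
    ∃ y : X, y ≠ x ∧ ∀ z : X, g • z = z ↔ z = x ∨ z = y :=
  (h.exists_character x).choose_spec.2 ⟨g, hx⟩ fun hχ => hg ⟨⟨g, hx⟩, hχ, rfl⟩

theorem not_mem_unipotentSubgroup_of_fixed (h : IsProjectiveLineAction p K G X) {x y : X} {g : G}
    (hg1 : g ≠ 1) (hy : g • y = y) (hxy : y ≠ x) : g ∉ h.unipotentSubgroup x :=
  fun hg => hxy (h.eq_of_mem_unipotentSubgroup hg hg1 hy)

/-- A nontrivial group element has at most two fixed points. -/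
theorem eq_one_of_three_fixed (h : IsProjectiveLineAction p K G X) {x y z : X} {g : G}
    (hxy : x ≠ y) (hxz : x ≠ z) (hyz : y ≠ z) (hx : g • x = x) (hy : g • y = y)
    (hz : g • z = z) : g = 1 := by
  by_contra hg1
  obtain ⟨w, -, hw⟩ := h.exists_other_fixed hx
    (h.not_mem_unipotentSubgroup_of_fixed hg1 hy hxy.symm)
  have h1 := ((hw y).mp hy).resolve_left hxy.symm
  have h2 := ((hw z).mp hz).resolve_left hxz.symm
  exact hyz (h1.trans h2.symm)

theorem finite_fixedBy (h : IsProjectiveLineAction p K G X) {g : G} (hg : g ≠ 1) :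
    (fixedBy X g).Finite := by
  obtain ⟨x, hx⟩ := h.exists_fixed g
  by_cases hu : g ∈ h.unipotentSubgroup x
  · exact (Set.finite_singleton x).subset fun y hy => h.eq_of_mem_unipotentSubgroup hu hg hy
  · obtain ⟨y, -, hy⟩ := h.exists_other_fixed hx hu
    exact (Set.toFinite {x, y}).subset fun z hz => (hy z).mp hz

theorem conj_mem_unipotentSubgroup (h : IsProjectiveLineAction p K G X) {x : X} (g u : G) :
    g * u * g⁻¹ ∈ h.unipotentSubgroup (g • x) ↔ u ∈ h.unipotentSubgroup x := by
  rw [mem_unipotentSubgroup, mem_unipotentSubgroup, conj_eq_one_iff]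
  refine and_congr (by simp [mul_smul]) (or_congr_right ⟨fun H y hy => ?_, fun H y hy => ?_⟩)
  · have := H (g • y) (by simp [mul_smul, hy])
    exact smul_left_cancel g this
  · rw [mul_smul, mul_smul, smul_eq_iff_eq_inv_smul] at hy
    rw [← H _ hy, smul_inv_smul]

theorem card_unipotentSubgroup_smul (h : IsProjectiveLineAction p K G X) (g : G) (x : X) :
    Nat.card (h.unipotentSubgroup (g • x)) = Nat.card (h.unipotentSubgroup x) := by
  refine (Nat.card_congr ((MulAut.conj g).toEquiv.subtypeEquiv fun u => ?_)).symm
  simpa using (h.conj_mem_unipotentSubgroup g u).symm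

theorem isPGroup_unipotentSubgroup (h : IsProjectiveLineAction p K G X) (x : X) :
    IsPGroup p (h.unipotentSubgroup x) := fun g =>
  ⟨1, Subtype.ext (by simpa using h.pow_eq_one_of_mem_unipotentSubgroup g.2)⟩

/-- Nontrivial unipotent elements commute only with unipotent elements. -/
theorem mem_unipotentSubgroup_of_commute (h : IsProjectiveLineAction p K G X) {x : X} {g u : G}
    (hu : u ∈ h.unipotentSubgroup x) (hu1 : u ≠ 1) (hg : g • x = x) (hgu : g * u = u * g) :
    g ∈ h.unipotentSubgroup x := by
  by_contra hgx
  obtain ⟨y, hyx, hy⟩ := h.exists_other_fixed hg hgx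
  have hgy : g • y = y := (hy y).mpr (Or.inr rfl)
  have huy : u • y = x ∨ u • y = y := (hy (u • y)).mp (by rw [← mul_smul, hgu, mul_smul, hgy])
  have hux : u • x = x := h.unipotentSubgroup_le x hu
  obtain huy | huy := huy
  · exact hyx (smul_left_cancel u (huy.trans hux.symm))
  · exact hyx (h.eq_of_mem_unipotentSubgroup hu hu1 huy)

theorem conj_mem_of_mem_stabilizer (h : IsProjectiveLineAction p K G X) {x : X} {g u : G}
    (hg : g • x = x) (hu : u ∈ h.unipotentSubgroup x) :
    g * u * g⁻¹ ∈ h.unipotentSubgroup x := by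
  simpa [hg] using (h.conj_mem_unipotentSubgroup g u).mpr hu

/-! ### Orders of stabilizers and orbits of finite groups -/

section Finite

variable [Finite G]

/-- In characteristic `p`, `u ^ p = 1` means `(u - 1) ^ p = 0`, so there is no element of order `p`
and Cauchy's theorem applies. -/
theorem card_units_subgroup_coprime [hp : Fact p.Prime] [CharP K p] (H : Subgroup Kˣ) [Finite H] :
    (Nat.card H).Coprime p := by
  rw [Nat.coprime_comm, hp.out.coprime_iff_not_dvd]
  intro hdvd
  obtain ⟨u, hu⟩ := exists_prime_orderOf_dvd_card' p hdvd
  have h1 : ((u : Kˣ) : K) ^ p = 1 := by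
    rw [← Units.val_pow_eq_pow_val, ← Subgroup.coe_pow, ← hu, pow_orderOf_eq_one]
    rfl
  have h2 : ((u : Kˣ) : K) = 1 := by
    have : (((u : Kˣ) : K) - 1) ^ p = 0 := by
      rw [sub_pow_char, h1, one_pow, sub_self]
    exact sub_eq_zero.mp (pow_eq_zero_iff hp.out.ne_zero |>.mp this)
  have h3 : u = 1 := Subtype.ext (Units.ext h2)
  rw [h3, orderOf_one] at hu
  exact hp.out.one_lt.ne hu

/-- The order of a point stabilizer is the product of the order of its unipotent subgroup and
of a number prime to `p`. -/
theorem exists_card_stabilizer [Fact p.Prime] [CharP K p] (h : IsProjectiveLineAction p K G X)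
    (x : X) : ∃ e : ℕ, e.Coprime p ∧
      Nat.card (stabilizer G x) = Nat.card (h.unipotentSubgroup x) * e := by
  have : Finite (h.exists_character x).choose.range := Set.finite_range _
  refine ⟨_, card_units_subgroup_coprime (p := p) (h.exists_character x).choose.range, ?_⟩
  rw [unipotentSubgroup, Subgroup.card_map_of_injective (stabilizer G x).subtype_injective,
    ← Subgroup.index_ker, Subgroup.card_mul_index]

/-- The character is injective here, and finite subgroups of `Kˣ` are cyclic. -/
theorem isCyclic_stabilizer (h : IsProjectiveLineAction p K G X) {x : X}
    (hx : h.unipotentSubgroup x = ⊥) : IsCyclic (stabilizer G x) := by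
  refine isCyclic_of_injective_ringHom ((Units.coeHom K).comp (h.exists_character x).choose) ?_
  refine Units.val_injective.comp ?_
  rw [← MonoidHom.ker_eq_bot_iff]
  exact (Subgroup.map_eq_bot_iff_of_injective _ (stabilizer G x).subtype_injective).mp hx

/-- A point stabilizer with nontrivial unipotent subgroup of order `q` has order at most
`q * (q - 1)`. -/
theorem card_stabilizer_le (h : IsProjectiveLineAction p K G X) {x : X}
    (hx : h.unipotentSubgroup x ≠ ⊥) :
    Nat.card (stabilizer G x) ≤
      Nat.card (h.unipotentSubgroup x) * (Nat.card (h.unipotentSubgroup x) - 1) := by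
  classical
  have := Fintype.ofFinite G
  obtain ⟨u, hu, hu1⟩ := (Subgroup.bot_or_exists_ne_one _).resolve_left hx
  let U : Finset G := {g | g ∈ h.unipotentSubgroup x}
  let S : Finset G := {g | g ∈ stabilizer G x}
  have hU : Nat.card (h.unipotentSubgroup x) = U.card := by
    rw [Nat.card_eq_fintype_card, Fintype.card_subtype]
  have hS : Nat.card (stabilizer G x) = S.card := by
    rw [Nat.card_eq_fintype_card, Fintype.card_subtype]
  have hU1 : (1 : G) ∈ U := by simp [U, one_mem]
  rw [hU, hS, ← Finset.card_erase_of_mem hU1]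
  -- Conjugating `u` maps the stabilizer to the nontrivial unipotent elements. Each fibre is a coset
  -- of the centralizer of `u` in the stabilizer, which is unipotent.
  refine Finset.card_le_mul_card_image_of_maps_to (f := fun g => g * u * g⁻¹)
    (fun g hg => ?_) _ fun v _ => ?_
  · have hg : g • x = x := by simpa [S] using hg
    simpa [U, hu1] using h.conj_mem_of_mem_stabilizer hg hu
  · obtain hempty | ⟨g₀, hg₀⟩ := Finset.eq_empty_or_nonempty {g ∈ S | g * u * g⁻¹ = v}
    · simp [hempty]
    · refine Finset.card_le_card_of_injOn (fun g => g₀⁻¹ * g) (fun g hg => ?_)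
        fun a _ b _ hab => mul_left_cancel hab
      simp only [S, Finset.mem_coe, Finset.mem_filter, Finset.mem_univ, true_and,
        mem_stabilizer_iff] at hg hg₀
      simp only [U, Finset.coe_filter, Finset.mem_univ, true_and, Set.mem_ofPred_eq]
      refine h.mem_unipotentSubgroup_of_commute hu hu1 ?_ ?_
      · rw [mul_smul, hg.1, inv_smul_eq_iff, hg₀.1]
      · have := hg.2.trans hg₀.2.symm
        rw [mul_inv_eq_iff_eq_mul] at this
        rw [mul_assoc, this]
        group

/-- The length of an orbit is congruent to `1` modulo the order of the unipotent subgroup of a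
point in it. -/
theorem exists_card_orbit_eq (h : IsProjectiveLineAction p K G X) (x : X) :
    ∃ t : ℕ, (stabilizer G x).index = 1 + Nat.card (h.unipotentSubgroup x) * t := by
  let Y := {y : X // y ∈ orbit G x ∧ y ≠ x}
  have hfin : (orbit G x).Finite := Set.finite_range _
  have : Finite Y := (hfin.subset fun y hy => hy.1).to_subtype
  have hfix : ∀ u : h.unipotentSubgroup x, (u : G) • x = x :=
    fun u => h.unipotentSubgroup_le x u.2
  let _ : MulAction (h.unipotentSubgroup x) Y :=
    { smul := fun u y => ⟨(u : G) • (y : X), mem_orbit_of_mem_orbit (u : G) y.2.1, fun hy => y.2.2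
        (smul_left_cancel (u : G) (hy.trans (hfix u).symm))⟩
      one_smul := fun y => Subtype.ext (one_smul G (y : X))
      mul_smul := fun u v y => Subtype.ext (mul_smul (u : G) (v : G) (y : X)) }
  -- The unipotent subgroup acts freely on the orbit with `x` removed, so its order divides the
  -- number of remaining points.
  have hfree : ∀ y : Y, stabilizer (h.unipotentSubgroup x) y = ⊥ := fun y => by
    rw [eq_bot_iff]
    intro u hu
    by_contra hu1
    exact y.2.2 (h.eq_of_mem_unipotentSubgroup u.2 (fun h => hu1 (Subtype.ext h))
      (congrArg Subtype.val hu))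
  refine ⟨Nat.card (orbitRel.Quotient (h.unipotentSubgroup x) Y), ?_⟩
  have hY : Nat.card Y = (orbit G x).ncard - 1 := by
    rw [← Set.ncard_sdiff_singleton_of_mem (mem_orbit_self x)]
    rfl
  have hpos : 0 < (orbit G x).ncard :=
    (Set.ncard_pos hfin).mpr ⟨x, mem_orbit_self x⟩
  rw [index_stabilizer, mul_comm]
  have := Nat.card_congr (selfEquivOrbitsQuotientProd hfree)
  rw [hY, Nat.card_prod] at this
  change _ = 1 + Nat.card (Quotient (orbitRel (h.unipotentSubgroup x) Y)) * _
  omega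

end Finite
end IsProjectiveLineAction

/-! ### The class equation -/

namespace IsProjectiveLineAction

variable {p : ℕ} {K G X : Type*} [Field K] [Group G] [MulAction G X]

theorem card_stabilizer_smul (g : G) (x : X) :
    Nat.card (stabilizer G (g • x)) = Nat.card (stabilizer G x) :=
  (Nat.card_congr (stabilizerEquivStabilizer (g := g) rfl).toEquiv).symm

variable [Finite G]

open scoped Classical in
/-- Counting fixed points of nontrivial elements, each unipotent one twice. -/
theorem sum_card_stabilizer (h : IsProjectiveLineAction p K G X) (T : Finset X)
    (hT : ∀ x, x ∈ T ↔ stabilizer G x ≠ ⊥) :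
    ∑ x ∈ T, ((Nat.card (stabilizer G x) : ℚ) + Nat.card (h.unipotentSubgroup x) - 2)
      = 2 * (Nat.card G - 1) := by
  have := Fintype.ofFinite G
  let A : Finset G := Finset.univ.erase 1
  obtain ⟨S, hS, hS'⟩ : ∃ S : X → Subgroup G, (∀ x g, g ∈ S x ↔ g • x = x) ∧
      ∀ x, stabilizer G x = S x := ⟨fun x => stabilizer G x, fun _ _ => Iff.rfl, fun _ => rfl⟩
  have hmemT : ∀ {g : G} {x : X}, g ≠ 1 → g • x = x → x ∈ T := fun {g x} hg hx =>
    (hT x).mpr fun hbot => hg (by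
      have : g ∈ stabilizer G x := hx
      rwa [hbot, Subgroup.mem_bot] at this)
  have hcard : ∀ H : Subgroup G, (Nat.card H : ℚ) = (A.filter (· ∈ H)).card + 1 := by
    intro H
    have h1 : (1 : G) ∈ (Finset.univ.filter (· ∈ H) : Finset G) := by simp [one_mem]
    rw [Nat.card_eq_fintype_card, Fintype.card_subtype, ← Finset.card_erase_add_one h1,
      Finset.filter_erase]
    push_cast
    rfl
  have hsum : ∀ H : X → Subgroup G, ∑ x ∈ T, ((A.filter (· ∈ H x)).card : ℚ)
      = ∑ g ∈ A, ((T.filter (fun x => g ∈ H x)).card : ℚ) := by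
    intro H
    exact_mod_cast Finset.sum_card_bipartiteAbove_eq_sum_card_bipartiteBelow
      (s := T) (t := A) (fun x g => g ∈ H x)
  -- The total is `1 + 1` for a unipotent element and `2 + 0` for any other.
  have htwo : ∀ g ∈ A, ((T.filter (fun x => g ∈ S x)).card : ℚ)
      + (T.filter (fun x => g ∈ h.unipotentSubgroup x)).card = 2 := by
    intro g hg
    have hg1 : g ≠ 1 := Finset.ne_of_mem_erase hg
    obtain ⟨x, hx⟩ := h.exists_fixed g
    by_cases hu : g ∈ h.unipotentSubgroup x
    · have e1 : T.filter (fun x => g ∈ S x) = {x} := by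
        ext y
        simp only [Finset.mem_filter, hS, Finset.mem_singleton]
        exact ⟨fun hy => h.eq_of_mem_unipotentSubgroup hu hg1 hy.2,
          fun hy => by subst hy; exact ⟨hmemT hg1 hx, hx⟩⟩
      have e2 : T.filter (fun x => g ∈ h.unipotentSubgroup x) = {x} := by
        ext y
        simp only [Finset.mem_filter, Finset.mem_singleton]
        exact ⟨fun hy => h.eq_of_mem_unipotentSubgroup hu hg1 (h.unipotentSubgroup_le y hy.2),
          fun hy => by subst hy; exact ⟨hmemT hg1 hx, hu⟩⟩
      rw [e1, e2, Finset.card_singleton]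
      norm_num
    · obtain ⟨y, hyx, hy⟩ := h.exists_other_fixed hx hu
      have hgy : g • y = y := (hy y).mpr (Or.inr rfl)
      have e1 : T.filter (fun x => g ∈ S x) = {x, y} := by
        ext z
        simp only [Finset.mem_filter, hS, Finset.mem_insert, Finset.mem_singleton]
        exact ⟨fun hz => (hy z).mp hz.2,
          fun hz => ⟨hmemT hg1 ((hy z).mpr hz), (hy z).mpr hz⟩⟩
      have e2 : T.filter (fun x => g ∈ h.unipotentSubgroup x) = ∅ := by
        rw [Finset.filter_eq_empty_iff]
        intro z _ hz
        have hxz := h.eq_of_mem_unipotentSubgroup hz hg1 hx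
        have hyz := h.eq_of_mem_unipotentSubgroup hz hg1 hgy
        exact hyx (hyz.trans hxz.symm)
      rw [e1, e2, Finset.card_pair hyx.symm]
      norm_num
  calc _ = ∑ x ∈ T, (((A.filter (· ∈ S x)).card : ℚ)
          + (A.filter (· ∈ h.unipotentSubgroup x)).card) := by
        refine Finset.sum_congr rfl fun x _ => ?_
        rw [hS', hcard, hcard]; ring
    _ = ∑ g ∈ A, (2 : ℚ) := by
        rw [Finset.sum_add_distrib, hsum, hsum, ← Finset.sum_add_distrib]
        exact Finset.sum_congr rfl htwo
    _ = _ := by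
        rw [Finset.sum_const, Finset.card_erase_of_mem (Finset.mem_univ _), Finset.card_univ,
          Nat.card_eq_fintype_card, nsmul_eq_mul, Nat.cast_sub Fintype.card_pos]
        push_cast; ring

/-- The class equation of the action: a relation between the orders of the stabilizers of
representatives of the nonregular orbits. -/
theorem exists_representatives (h : IsProjectiveLineAction p K G X) :
    ∃ R : Finset X, (∀ x ∈ R, stabilizer G x ≠ ⊥) ∧
      (∀ y, stabilizer G y ≠ ⊥ → ∃ x ∈ R, y ∈ orbit G x) ∧
      (∀ x ∈ R, ∀ y ∈ R, y ∈ orbit G x → y = x) ∧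
      ∑ x ∈ R, (1 + ((Nat.card (h.unipotentSubgroup x) : ℚ) - 2) / Nat.card (stabilizer G x))
        = 2 - 2 / Nat.card G := by
  classical
  have hfin : {x : X | stabilizer G x ≠ ⊥}.Finite := by
    refine (Set.finite_iUnion fun g : {g : G // g ≠ 1} => h.finite_fixedBy g.2).subset
      fun x hx => ?_
    obtain ⟨g, hg, hg1⟩ := (Subgroup.bot_or_exists_ne_one _).resolve_left hx
    exact Set.mem_iUnion.mpr ⟨⟨g, hg1⟩, hg⟩
  let T := hfin.toFinset
  have hT : ∀ x, x ∈ T ↔ stabilizer G x ≠ ⊥ := fun x => hfin.mem_toFinset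
  have hTsmul : ∀ (g : G) {x : X}, x ∈ T → g • x ∈ T := fun g x hx => by
    rw [hT, ← Subgroup.one_lt_card_iff_ne_bot] at hx ⊢
    rwa [card_stabilizer_smul]
  let r : X → X := fun x => (Quotient.mk (orbitRel G X) x).out
  have hr : ∀ x, ∃ g : G, g • x = r x := fun x =>
    Quotient.exact (s := orbitRel G X) (Quotient.out_eq (Quotient.mk (orbitRel G X) x))
  have hrsmul : ∀ (g : G) x, r (g • x) = r x := fun g x =>
    congrArg Quotient.out (Quotient.sound (s := orbitRel G X) ⟨g, rfl⟩)
  have hrr : ∀ x, r (r x) = r x := fun x => by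
    obtain ⟨g, hg⟩ := hr x
    conv_lhs => rw [← hg]
    exact hrsmul g x
  have hRT : ∀ x ∈ T.image r, x ∈ T ∧ r x = x := by
    intro x hx
    obtain ⟨y, hy, rfl⟩ := Finset.mem_image.mp hx
    obtain ⟨g, hg⟩ := hr y
    exact ⟨hg ▸ hTsmul g hy, hrr y⟩
  refine ⟨T.image r, fun x hx => (hT x).mp (hRT x hx).1, fun y hy => ?_, fun x hx y hy hxy => ?_,
    ?_⟩
  · obtain ⟨g, hg⟩ := hr y
    exact ⟨r y, Finset.mem_image_of_mem r ((hT y).mpr hy), hg ▸ ⟨g⁻¹, inv_smul_smul g y⟩⟩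
  · obtain ⟨g, hg : g • x = y⟩ := hxy
    rw [← (hRT x hx).2, ← (hRT y hy).2, ← hg, hrsmul]
  · have hN : (Nat.card G : ℚ) ≠ 0 := Nat.cast_ne_zero.mpr Nat.card_pos.ne'
    have key := h.sum_card_stabilizer T hT
    rw [← Finset.sum_fiberwise_of_maps_to (fun x hx => Finset.mem_image_of_mem r hx)] at key
    -- The fibre of `r` over `x` is the orbit of `x`: it has `|G| / s` points, each contributing `s
    -- + u - 2`.
    have hterm : ∀ x ∈ T.image r, ∑ y ∈ T with r y = x,
        ((Nat.card (stabilizer G y) : ℚ) + Nat.card (h.unipotentSubgroup y) - 2)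
        = Nat.card G *
          (1 + ((Nat.card (h.unipotentSubgroup x) : ℚ) - 2) / Nat.card (stabilizer G x)) := by
      intro x hx
      obtain ⟨hxT, hrx⟩ := hRT x hx
      have horb : ∀ y, (y ∈ T ∧ r y = x) ↔ y ∈ orbit G x := by
        intro y
        constructor
        · rintro ⟨-, hy⟩
          obtain ⟨g, hg⟩ := hr y
          exact ⟨g⁻¹, by rw [← hy, ← hg]; exact inv_smul_smul g y⟩
        · rintro ⟨g, rfl⟩
          exact ⟨hTsmul g hxT, (hrsmul g x).trans hrx⟩
      have hcard : (T.filter (r · = x)).card = (stabilizer G x).index := by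
        rw [index_stabilizer, ← Set.ncard_coe_finset]
        congr 1
        ext y
        simpa using horb y
      rw [Finset.sum_congr rfl (g := fun _ => (Nat.card (stabilizer G x) : ℚ)
        + Nat.card (h.unipotentSubgroup x) - 2), Finset.sum_const, hcard, nsmul_eq_mul,
        ← (stabilizer G x).card_mul_index, Nat.cast_mul]
      · have hs : (Nat.card (stabilizer G x) : ℚ) ≠ 0 := Nat.cast_ne_zero.mpr Nat.card_pos.ne'
        field_simp
        ring
      · intro y hy
        obtain ⟨g, rfl⟩ := (horb y).mp (Finset.mem_filter.mp hy)
        simp only [card_stabilizer_smul, h.card_unipotentSubgroup_smul]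
    rw [Finset.sum_congr rfl hterm, ← Finset.mul_sum] at key
    field_simp
    linear_combination key

end IsProjectiveLineAction

/-! ### Groups of order divisible by the characteristic -/

/-- An element of odd order is a power of its square, and squares lie in a subgroup of index 2. -/
theorem Subgroup.characteristic_of_index_two_of_odd_card {G : Type*} [Group G] (C : Subgroup G)
    (hC : C.index = 2) (hodd : Odd (Nat.card C)) : C.Characteristic := by
  rw [Subgroup.characteristic_iff_map_le]
  rintro φ _ ⟨g, hg, rfl⟩
  obtain ⟨n, hn⟩ := hodd
  have hpow : g ^ (2 * n + 1) = 1 := by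
    have : (⟨g, hg⟩ : C) ^ (2 * n + 1) = 1 := by rw [← hn]; exact pow_card_eq_one'
    simpa using congrArg Subtype.val this
  have key : φ g = ((φ g ^ 2) ^ n)⁻¹ := by
    rw [eq_inv_iff_mul_eq_one, ← pow_mul, ← pow_succ', ← map_pow, hpow, map_one]
  change φ g ∈ C
  rw [key]
  exact C.inv_mem (C.pow_mem (Subgroup.sq_mem_of_index_two hC _) n)

/-- Here `r + 2` is the Sylow order `q`, `1 + q t` the length of the wild orbit, and `d` the order
of a tame stabilizer. Dividing by `q` leaves `e (1 + q t) = d (1 + r t)`. Since `1 + q t = (1 + r t)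
+ 2 t` and `1 + r t` is prime to `t`, it follows that `1 + r t ∣ 2 e`, so `1 + r t ≤ 2 r + 2`. For
`r > 0` and `t ≥ 2` this leaves only `r = 1`, `t = 3`, `e = 2`. -/
theorem modular_class_equation_bound {r e t d : ℕ} (he0 : 0 < e) (he : e ≤ r + 1)
    (h : e * (1 + (r + 2) * t) * (r + 2) = d * ((1 + (r + 2) * t) * r + 2)) :
    (r + 2) * e * (1 + (r + 2) * t) ≤ (r + 2) ^ 3 ∨
      (r = 1 ∧ (r + 2) * e * (1 + (r + 2) * t) = 60) ∨
      (r = 0 ∧ (r + 2) * e * (1 + (r + 2) * t) = 2 * d) := by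
  have h1 : e * (1 + (r + 2) * t) = d * (1 + t * r) :=
    Nat.eq_of_mul_eq_mul_right (by omega : 0 < r + 2) (by rw [h]; ring)
  have hdvd : 1 + t * r ∣ 2 * e := by
    have h2 : 1 + t * r ∣ t * (2 * e) := by
      refine (Nat.dvd_add_right (b := e * (1 + t * r)) (Dvd.intro_left e rfl)).mp ?_
      exact ⟨d, by rw [mul_comm (1 + t * r) d, ← h1]; ring⟩
    refine Nat.Coprime.dvd_of_dvd_mul_left ?_ h2
    simp [Nat.coprime_add_mul_left_left]
  have hle : 1 + t * r ≤ 2 * e := Nat.le_of_dvd (by omega) hdvd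
  obtain rfl | rfl | ht : t = 0 ∨ t = 1 ∨ 2 ≤ t := by omega
  · left
    calc (r + 2) * e * (1 + (r + 2) * 0) ≤ (r + 2) * (r + 1) * 1 := by gcongr; omega
      _ ≤ (r + 2) * (r + 2) * (r + 2) := by gcongr <;> omega
      _ = (r + 2) ^ 3 := by ring
  · left
    calc (r + 2) * e * (1 + (r + 2) * 1) ≤ (r + 2) * (r + 1) * (1 + (r + 2) * 1) := by gcongr
      _ ≤ (r + 2) ^ 3 := by nlinarith
  · obtain rfl | hr := Nat.eq_zero_or_pos r
    · refine Or.inr (Or.inr ⟨rfl, ?_⟩)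
      linarith
    · obtain rfl | ht : t = 2 ∨ 3 ≤ t := by omega
      · have : 1 + 2 * r ∣ e := Nat.Coprime.dvd_of_dvd_mul_left (by simp) hdvd
        have := Nat.le_of_dvd he0 this
        omega
      · have : t * r ≤ 2 * r + 1 := by omega
        have hr1 : r = 1 := by nlinarith
        subst hr1
        have ht3 : t = 3 := by omega
        subst ht3
        refine Or.inr (Or.inl ⟨rfl, ?_⟩)
        have : e = 2 := by omega
        subst this
        norm_num

namespace IsProjectiveLineAction

variable {p : ℕ} {K G X : Type*} [Field K] [Group G] [MulAction G X] [Finite G]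
  [hp : Fact p.Prime] [CharP K p]

/-- The index is `e (1 + q t)`, with `e` prime to `p` and `p ∣ q`; hence the unipotent subgroup is a
Sylow subgroup. -/
theorem not_dvd_index_unipotentSubgroup (h : IsProjectiveLineAction p K G X) {x : X}
    (hx : h.unipotentSubgroup x ≠ ⊥) : ¬ p ∣ (h.unipotentSubgroup x).index := by
  obtain ⟨e, he, hs⟩ := h.exists_card_stabilizer x
  obtain ⟨t, ht⟩ := h.exists_card_orbit_eq x
  have hpu : p ∣ Nat.card (h.unipotentSubgroup x) :=
    (h.isPGroup_unipotentSubgroup x).card_eq_or_dvd.resolve_left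
      ((Subgroup.one_lt_card_iff_ne_bot _).mpr hx).ne'
  have hu0 : 0 < Nat.card (h.unipotentSubgroup x) := Nat.card_pos
  have hindex : (h.unipotentSubgroup x).index = e * (stabilizer G x).index := by
    refine Nat.eq_of_mul_eq_mul_left hu0 ?_
    rw [Subgroup.card_mul_index, ← mul_assoc, ← hs, Subgroup.card_mul_index]
  rw [hindex, ht, hp.out.dvd_mul]
  rintro (h1 | h1)
  · exact hp.out.one_lt.ne' (Nat.eq_one_of_dvd_coprimes he.symm dvd_rfl h1)
  · exact hp.out.not_dvd_one ((Nat.dvd_add_left (hpu.mul_right t)).mp h1)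

theorem card_sylow_eq (h : IsProjectiveLineAction p K G X) {x : X}
    (hx : h.unipotentSubgroup x ≠ ⊥) (P : Sylow p G) :
    Nat.card P = Nat.card (h.unipotentSubgroup x) := by
  let Q := (h.isPGroup_unipotentSubgroup x).toSylow (h.not_dvd_index_unipotentSubgroup hx)
  exact Nat.card_congr (P.equiv Q).toEquiv

/-- Sylow subgroups are conjugate, and a nontrivial unipotent element determines its fixed point. -/
theorem mem_orbit_of_unipotentSubgroup_ne_bot (h : IsProjectiveLineAction p K G X) {x y : X}
    (hx : h.unipotentSubgroup x ≠ ⊥) (hy : h.unipotentSubgroup y ≠ ⊥) : y ∈ orbit G x := by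
  let P := (h.isPGroup_unipotentSubgroup x).toSylow (h.not_dvd_index_unipotentSubgroup hx)
  let Q := (h.isPGroup_unipotentSubgroup y).toSylow (h.not_dvd_index_unipotentSubgroup hy)
  obtain ⟨g, hg⟩ := exists_smul_eq G P Q
  obtain ⟨u, hu, hu1⟩ := (Subgroup.bot_or_exists_ne_one _).resolve_left hx
  have hQ : g * u * g⁻¹ ∈ Q := by
    rw [← hg]
    exact Subgroup.smul_mem_pointwise_smul u (MulAut.conj g) (P : Subgroup G) hu
  have hmem : g * u * g⁻¹ ∈ h.unipotentSubgroup y := hQ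
  refine ⟨g, h.eq_of_mem_unipotentSubgroup hmem (by rwa [Ne, conj_eq_one_iff]) ?_⟩
  have hux : u • x = x := h.unipotentSubgroup_le x hu
  simp [mul_smul, hux]

theorem exists_unipotentSubgroup_ne_bot (h : IsProjectiveLineAction p K G X)
    (hdvd : p ∣ Nat.card G) : ∃ x : X, h.unipotentSubgroup x ≠ ⊥ := by
  obtain ⟨g, hg⟩ := exists_prime_orderOf_dvd_card' p hdvd
  obtain ⟨x, hx⟩ := h.exists_fixed g
  refine ⟨x, fun hbot => ?_⟩
  obtain ⟨e, he, hs⟩ := h.exists_card_stabilizer x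
  rw [hbot, Subgroup.card_bot, one_mul] at hs
  have h1 : p ∣ e := by
    rw [← hg, ← hs]
    exact (stabilizer G x).orderOf_dvd_natCard hx
  exact hp.out.one_lt.ne' (Nat.eq_one_of_dvd_coprimes he.symm dvd_rfl h1)

theorem card_stabilizer_coprime (h : IsProjectiveLineAction p K G X) {x : X}
    (hx : h.unipotentSubgroup x = ⊥) : (Nat.card (stabilizer G x)).Coprime p := by
  obtain ⟨e, he, hs⟩ := h.exists_card_stabilizer x
  rwa [hs, hx, Subgroup.card_bot, one_mul]

/-- The case of groups of order divisible by the characteristic. -/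
theorem card_bound_of_dvd (h : IsProjectiveLineAction p K G X) (hdvd : p ∣ Nat.card G)
    (P : Sylow p G) : Nat.card G ≤ Nat.card P ^ 3 ∨ (p = 3 ∧ Nat.card P = 3 ∧ Nat.card G = 60) ∨
      ∃ C : Subgroup G, C.Characteristic ∧ IsCyclic C ∧ (Nat.card C).Coprime p ∧ C.index = 2 := by
  classical
  obtain ⟨R, hR, hRall, hRuniq, hsum⟩ := h.exists_representatives
  obtain ⟨x₁, hx₁⟩ := h.exists_unipotentSubgroup_ne_bot hdvd
  obtain ⟨x, hxR, g, rfl⟩ := hRall x₁ fun hbot => hx₁ (by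
    rw [eq_bot_iff, ← hbot]; exact h.unipotentSubgroup_le _)
  have hx : h.unipotentSubgroup x ≠ ⊥ := by
    rw [← Subgroup.one_lt_card_iff_ne_bot] at hx₁ ⊢
    rwa [← h.card_unipotentSubgroup_smul g]
  have htame : ∀ y ∈ R.erase x, h.unipotentSubgroup y = ⊥ := fun y hy => by
    by_contra hne
    exact Finset.ne_of_mem_erase hy (hRuniq x hxR y (Finset.mem_of_mem_erase hy)
      (h.mem_orbit_of_unipotentSubgroup_ne_bot hx hne))
  have hq : Nat.card P = Nat.card (h.unipotentSubgroup x) := h.card_sylow_eq hx P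
  obtain ⟨e, he, hs⟩ := h.exists_card_stabilizer x
  obtain ⟨t, ht⟩ := h.exists_card_orbit_eq x
  have hle := h.card_stabilizer_le hx
  have hN := (stabilizer G x).card_mul_index
  have hu1 := (Subgroup.one_lt_card_iff_ne_bot _).mpr hx
  have hpu : p ∣ Nat.card (h.unipotentSubgroup x) :=
    (h.isPGroup_unipotentSubgroup x).card_eq_or_dvd.resolve_left hu1.ne'
  have hs0 : 0 < Nat.card (stabilizer G x) := Nat.card_pos
  have hN0 : 0 < Nat.card G := Nat.card_pos
  rw [← Finset.add_sum_erase _ _ hxR] at hsum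
  have hhalf : ∀ y ∈ R.erase x, (1 / 2 : ℚ) ≤
      1 + ((Nat.card (h.unipotentSubgroup y) : ℚ) - 2) / Nat.card (stabilizer G y) := fun y hy => by
    have h2 : (2 : ℚ) ≤ Nat.card (stabilizer G y) := by
      exact_mod_cast (Subgroup.one_lt_card_iff_ne_bot _).mpr (hR y (Finset.mem_of_mem_erase hy))
    rw [htame y hy, Subgroup.card_bot, Nat.cast_one]
    have : (1 : ℚ) / Nat.card (stabilizer G y) ≤ 1 / 2 :=
      one_div_le_one_div_of_le (by norm_num) h2
    have e : ((1 : ℚ) - 2) / Nat.card (stabilizer G y) = -(1 / Nat.card (stabilizer G y)) := by ring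
    rw [e]
    linarith
  -- The wild orbit contributes at least `1` and each tame one at least `1 / 2`, while the total is
  -- below `2`.
  have hcard : (R.erase x).card ≤ 1 := by
    by_contra! hlt
    have h1 := Finset.card_nsmul_le_sum _ _ _ hhalf
    have h2 : (2 : ℚ) ≤ (R.erase x).card := by exact_mod_cast hlt
    have h3 : (0 : ℚ) ≤ ((Nat.card (h.unipotentSubgroup x) : ℚ) - 2)
        / Nat.card (stabilizer G x) := by
      refine div_nonneg ?_ (Nat.cast_nonneg _)
      have : (2 : ℚ) ≤ Nat.card (h.unipotentSubgroup x) := by exact_mod_cast hu1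
      linarith
    have h4 : (0 : ℚ) < 2 / Nat.card G := by positivity
    rw [nsmul_eq_mul] at h1
    linarith
  obtain ⟨r, hr⟩ : ∃ r, Nat.card (h.unipotentSubgroup x) = r + 2 :=
    ⟨_, (Nat.sub_add_cancel hu1).symm⟩
  have hs0' : (Nat.card (stabilizer G x) : ℚ) ≠ 0 := by exact_mod_cast hs0.ne'
  have hN0' : (Nat.card G : ℚ) ≠ 0 := by exact_mod_cast hN0.ne'
  rw [hr] at hs ht hle hsum
  have he0 : 0 < e := Nat.pos_of_ne_zero fun h0 => by rw [h0] at hs; omega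
  have her : e ≤ r + 1 := by
    rw [hs] at hle
    exact Nat.le_of_mul_le_mul_left hle (by omega)
  rw [hq, hr]
  obtain hempty | ⟨y, hy⟩ := (Nat.le_one_iff_eq_zero_or_eq_one.mp hcard).imp
    Finset.card_eq_zero.mp Finset.card_eq_one.mp
  -- Without a tame orbit the class equation forces `G` to fix `x`.
  · left
    rw [hempty, Finset.sum_empty] at hsum
    have key : Nat.card G * r + 2 * Nat.card (stabilizer G x)
        = Nat.card G * Nat.card (stabilizer G x) := by
      push_cast at hsum
      field_simp at hsum
      have : (Nat.card G * r + 2 * Nat.card (stabilizer G x) : ℚ)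
        = Nat.card G * Nat.card (stabilizer G x) := by linear_combination hsum
      exact_mod_cast this
    have hge : r + 2 ≤ Nat.card (stabilizer G x) := by rw [hs]; nlinarith
    have : Nat.card G ≤ Nat.card (stabilizer G x) := by nlinarith
    calc Nat.card G ≤ (r + 2) * (r + 2 - 1) := this.trans hle
      _ ≤ (r + 2) * (r + 2) ^ 2 :=
        Nat.mul_le_mul_left _ ((Nat.sub_le _ _).trans (Nat.le_self_pow two_ne_zero _))
      _ = (r + 2) ^ 3 := by ring
  · have hyR : y ∈ R.erase x := by rw [hy]; exact Finset.mem_singleton_self y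
    rw [hy, Finset.sum_singleton, htame y hyR, Subgroup.card_bot] at hsum
    have hd0 : 0 < Nat.card (stabilizer G y) := Nat.card_pos
    have hNq : Nat.card G = (r + 2) * e * (1 + (r + 2) * t) := by rw [← hN, hs, ht]
    have key : e * (1 + (r + 2) * t) * (r + 2)
        = Nat.card (stabilizer G y) * ((1 + (r + 2) * t) * r + 2) := by
      have hd0' : (Nat.card (stabilizer G y) : ℚ) ≠ 0 := by exact_mod_cast hd0.ne'
      have he0' : (e : ℚ) ≠ 0 := by exact_mod_cast he0.ne'
      rw [hNq, hs] at hsum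
      push_cast at hsum
      have hr2 : (r + 2 : ℚ) ≠ 0 := by positivity
      have ht2 : (1 + (r + 2) * t : ℚ) ≠ 0 := by positivity
      field_simp at hsum
      have : (e * (1 + (r + 2) * t) * (r + 2) : ℚ)
        = Nat.card (stabilizer G y) * ((1 + (r + 2) * t) * r + 2) := by
        linear_combination -hsum
      exact_mod_cast this
    obtain h1 | ⟨rfl, h2⟩ | ⟨rfl, h3⟩ := modular_class_equation_bound he0 her key
    · left; rwa [hNq]
    · refine Or.inr (Or.inl ⟨?_, rfl, hNq.trans h2⟩)
      rw [hr] at hpu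
      exact (Nat.prime_dvd_prime_iff_eq hp.out Nat.prime_three).mp hpu
    · have hindex : (stabilizer G y).index = 2 := by
        have := (stabilizer G y).card_mul_index
        rw [hNq, h3] at this
        exact Nat.eq_of_mul_eq_mul_left hd0 (by rw [this, mul_comm])
      have hcop := h.card_stabilizer_coprime (htame y hyR)
      have hp2 : p = 2 := by
        rw [hr] at hpu
        exact (Nat.prime_dvd_prime_iff_eq hp.out Nat.prime_two).mp hpu
      refine Or.inr (Or.inr ⟨stabilizer G y, ?_, h.isCyclic_stabilizer (htame y hyR), hcop, hindex⟩)
      refine Subgroup.characteristic_of_index_two_of_odd_card _ hindex ?_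
      rwa [hp2, Nat.coprime_two_right] at hcop

end IsProjectiveLineAction

/-! ### Groups of order prime to the characteristic -/

theorem Finset.exists_sorted_of_card_eq_three {X : Type*} [DecidableEq X] {R : Finset X}
    (hR : R.card = 3) (f : X → ℕ) : ∃ a b c, a ≠ b ∧ a ≠ c ∧ b ≠ c ∧ R = {a, b, c} ∧
      f a ≤ f b ∧ f b ≤ f c := by
  obtain ⟨a, ha, hmin⟩ := R.exists_min_image f (Finset.card_pos.mp (by omega))
  obtain ⟨b, c, hbc, he⟩ := Finset.card_eq_two.mp (show (R.erase a).card = 2 by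
    rw [Finset.card_erase_of_mem ha, hR])
  have hb : b ∈ R.erase a := by simp [he]
  have hc : c ∈ R.erase a := by simp [he]
  have hRe : R = {a, b, c} := by rw [← he, Finset.insert_erase ha]
  rw [Finset.mem_erase] at hb hc
  obtain hle | hle := le_total (f b) (f c)
  · exact ⟨a, b, c, hb.1.symm, hc.1.symm, hbc, hRe, hmin b hb.2, hle⟩
  · exact ⟨a, c, b, hc.1.symm, hb.1.symm, hbc.symm, by rw [hRe, Finset.pair_comm b c],
      hmin c hc.2, hle⟩

/-- The reciprocals sum to more than `1`, which forces `a = 2`, then `b ≤ 3`, and `c ≤ 5` if `b =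
3`. -/
theorem spherical_triples {a b c N : ℕ} (ha : 2 ≤ a) (hab : a ≤ b) (hbc : b ≤ c) (hN : 0 < N)
    (h : (1 / a + 1 / b + 1 / c : ℚ) = 1 + 2 / N) :
    (a = 2 ∧ b = 2 ∧ N = 2 * c) ∨ (a = 2 ∧ b = 3 ∧ c = 3 ∧ N = 12) ∨
      (a = 2 ∧ b = 3 ∧ c = 4 ∧ N = 24) ∨ N = 60 := by
  have key : N * (b * c + a * c + a * b) = a * b * c * (N + 2) := by
    have ha' : (a : ℚ) ≠ 0 := by exact_mod_cast (by omega : a ≠ 0)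
    have hb' : (b : ℚ) ≠ 0 := by exact_mod_cast (by omega : b ≠ 0)
    have hc' : (c : ℚ) ≠ 0 := by exact_mod_cast (by omega : c ≠ 0)
    have hN' : (N : ℚ) ≠ 0 := by exact_mod_cast (by omega : N ≠ 0)
    field_simp at h
    have : (N * (b * c + a * c + a * b) : ℚ) = a * b * c * (N + 2) := by linear_combination h
    exact_mod_cast this
  have hpos : 0 < a * b * c := by
    have : 0 < b := by omega
    have : 0 < c := by omega
    positivity
  have hlt : a * b * c < b * c + a * c + a * b := by nlinarith
  obtain rfl : a = 2 := by
    by_contra hne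
    have h3 : 3 ≤ a := by omega
    have h1 : a * b ≤ b * c := by nlinarith
    have h2 : a * c ≤ b * c := Nat.mul_le_mul_right _ hab
    have h3 : 3 * (b * c) ≤ a * (b * c) := Nat.mul_le_mul_right _ h3
    nlinarith
  have hb4 : b < 4 := by
    by_contra! hb
    have : 4 * c ≤ b * c := Nat.mul_le_mul_right _ hb
    nlinarith
  obtain rfl | rfl : b = 2 ∨ b = 3 := by omega
  · exact Or.inl ⟨rfl, rfl, by nlinarith⟩
  · have hc6 : c < 6 := by omega
    have : c = 3 ∨ c = 4 ∨ c = 5 := by omega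
    obtain rfl | rfl | rfl := this <;> omega

namespace IsProjectiveLineAction

variable {p : ℕ} {K G X : Type*} [Field K] [Group G] [MulAction G X]

theorem card_stabilizer_of_mem_orbit {x y : X} (hy : y ∈ orbit G x) :
    Nat.card (stabilizer G y) = Nat.card (stabilizer G x) := by
  obtain ⟨g, rfl⟩ := hy
  exact card_stabilizer_smul g x

theorem stabilizer_ne_bot_of_fixed {y : X} {g : G} (hg1 : g ≠ 1) (hg : g • y = y) :
    stabilizer G y ≠ ⊥ := fun hbot => hg1 (by
  have : g ∈ stabilizer G y := hg
  rwa [hbot, Subgroup.mem_bot] at this)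

variable [Finite G]

/-- The class equation for groups of order prime to the characteristic. -/
theorem exists_signature (h : IsProjectiveLineAction p K G X)
    (hu : ∀ x, h.unipotentSubgroup x = ⊥) : (∃ x : X, stabilizer G x = ⊤) ∨
      ∃ a b c : X, (∀ y, stabilizer G y ≠ ⊥ → y ∈ orbit G a ∨ y ∈ orbit G b ∨ y ∈ orbit G c) ∧
        ((Nat.card (stabilizer G a) = 2 ∧ Nat.card (stabilizer G b) = 2 ∧
            Nat.card G = 2 * Nat.card (stabilizer G c) ∧ 2 ≤ Nat.card (stabilizer G c)) ∨
          (Nat.card (stabilizer G a) = 2 ∧ Nat.card (stabilizer G b) = 3 ∧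
            Nat.card (stabilizer G c) = 3 ∧ Nat.card G = 12) ∨
          (Nat.card (stabilizer G a) = 2 ∧ Nat.card (stabilizer G b) = 3 ∧
            Nat.card (stabilizer G c) = 4 ∧ Nat.card G = 24) ∨ Nat.card G = 60) := by
  classical
  have hNpos : 0 < Nat.card G := Nat.card_pos
  obtain hN1 | hN2 : Nat.card G = 1 ∨ 2 ≤ Nat.card G := by omega
  · obtain ⟨x, -⟩ := h.exists_fixed 1
    have := (Nat.card_eq_one_iff_unique.mp hN1).1
    exact Or.inl ⟨x, Subsingleton.elim _ _⟩
  obtain ⟨R, hR, hRall, -, hsum⟩ := h.exists_representatives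
  have hterm : ∀ x, (1 + ((Nat.card (h.unipotentSubgroup x) : ℚ) - 2) / Nat.card (stabilizer G x))
      = 1 - 1 / Nat.card (stabilizer G x) := fun x => by
    rw [hu x, Subgroup.card_bot]; ring
  rw [Finset.sum_congr rfl fun x _ => hterm x] at hsum
  have h2 : ∀ x ∈ R, 2 ≤ Nat.card (stabilizer G x) := fun x hx =>
    (Subgroup.one_lt_card_iff_ne_bot _).mpr (hR x hx)
  have hNQ : (2 : ℚ) ≤ Nat.card G := by exact_mod_cast hN2
  have hN0 : (0 : ℚ) < 2 / Nat.card G := by positivity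
  have hN1 : (2 : ℚ) / Nat.card G ≤ 1 := by rw [div_le_one (by positivity)]; exact hNQ
  have hupper : R.card < 4 := by
    by_contra! hlt
    have h1 : ∀ x ∈ R, (1 / 2 : ℚ) ≤ 1 - 1 / Nat.card (stabilizer G x) := fun x hx => by
      have : (2 : ℚ) ≤ Nat.card (stabilizer G x) := by exact_mod_cast h2 x hx
      have := one_div_le_one_div_of_le (by norm_num) this
      linarith
    have h3 := Finset.card_nsmul_le_sum _ _ _ h1
    have h4 : (4 : ℚ) ≤ R.card := by exact_mod_cast hlt
    rw [nsmul_eq_mul] at h3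
    linarith
  have hlower : 2 ≤ R.card := by
    by_contra! hlt
    obtain h0 | h1 : R.card = 0 ∨ R.card = 1 := by omega
    · rw [Finset.card_eq_zero.mp h0, Finset.sum_empty] at hsum
      linarith
    · obtain ⟨x, rfl⟩ := Finset.card_eq_one.mp h1
      rw [Finset.sum_singleton] at hsum
      have : (0 : ℚ) < 1 / Nat.card (stabilizer G x) := by
        have := h2 x (Finset.mem_singleton_self x)
        positivity
      linarith
  -- Each orbit contributes between `1 / 2` and `1`, and the total lies in `[1, 2)`. With two
  -- orbits, the reciprocals of the stabilizer orders sum to `2 / |G|`, so both stabilizers are all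
  -- of `G`.
  obtain hc | hc : R.card = 2 ∨ R.card = 3 := by omega
  · left
    obtain ⟨x, y, hxy, rfl⟩ := Finset.card_eq_two.mp hc
    rw [Finset.sum_pair hxy] at hsum
    refine ⟨x, Subgroup.eq_top_of_le_card _ ?_⟩
    have hx := h2 x (by simp)
    have hy : Nat.card (stabilizer G y) ≤ Nat.card G := Subgroup.card_le_card_group _
    have hy0 : 0 < Nat.card (stabilizer G y) := Nat.card_pos
    have h1 : (1 : ℚ) / Nat.card G ≤ 1 / Nat.card (stabilizer G y) :=
      one_div_le_one_div_of_le (by exact_mod_cast hy0) (by exact_mod_cast hy)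
    have h3 : (2 : ℚ) / Nat.card G = 2 * (1 / Nat.card G) := by ring
    have h4 : (1 : ℚ) / Nat.card (stabilizer G x) ≤ 1 / Nat.card G := by linarith
    have h5 := le_of_one_div_le_one_div (by positivity) h4
    exact_mod_cast h5
  · right
    obtain ⟨a, b, c, hab, hac, hbc, rfl, hle1, hle2⟩ :=
      Finset.exists_sorted_of_card_eq_three hc fun x => Nat.card (stabilizer G x)
    have hsum' : (1 / Nat.card (stabilizer G a) + 1 / Nat.card (stabilizer G b)
        + 1 / Nat.card (stabilizer G c) : ℚ) = 1 + 2 / Nat.card G := by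
      rw [Finset.sum_insert (by simp [hab, hac]), Finset.sum_pair hbc] at hsum
      linarith
    refine ⟨a, b, c, fun y hy => ?_, ?_⟩
    · obtain ⟨x, hx, hyx⟩ := hRall y hy
      simp only [Finset.mem_insert, Finset.mem_singleton] at hx
      obtain rfl | rfl | rfl := hx
      · exact Or.inl hyx
      · exact Or.inr (Or.inl hyx)
      · exact Or.inr (Or.inr hyx)
    · have h2c := h2 c (by simp)
      obtain ⟨h1, h3, h4⟩ | h1 | h1 | h1 :=
        spherical_triples (h2 a (by simp)) hle1 hle2 hNpos hsum'
      · exact Or.inl ⟨h1, h3, h4, h2c⟩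
      · exact Or.inr (Or.inl h1)
      · exact Or.inr (Or.inr (Or.inl h1))
      · exact Or.inr (Or.inr (Or.inr h1))

theorem eq_one_of_forall_mem_orbit (h : IsProjectiveLineAction p K G X) {x : X} {g : G}
    (hx : 2 < (stabilizer G x).index) (hg : ∀ y ∈ orbit G x, g • y = y) : g = 1 := by
  have hfin : (orbit G x).Finite := Set.finite_range _
  rw [index_stabilizer, Set.two_lt_ncard_iff hfin] at hx
  obtain ⟨a, b, c, ha, hb, hc, hab, hac, hbc⟩ := hx
  exact h.eq_one_of_three_fixed hab hac hbc (hg a ha) (hg b hb) (hg c hc)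

/-- An automorphism sends a generator to an element of the same order, at least 3. Such an element
can only fix points in the orbit of `c`, whose stabilizers all coincide with that of `c` by
normality. -/
theorem characteristic_stabilizer_of_index_two (h : IsProjectiveLineAction p K G X) {a b c : X}
    (hu : h.unipotentSubgroup c = ⊥)
    (hall : ∀ y, stabilizer G y ≠ ⊥ → y ∈ orbit G a ∨ y ∈ orbit G b ∨ y ∈ orbit G c)
    (ha : Nat.card (stabilizer G a) = 2) (hb : Nat.card (stabilizer G b) = 2)
    (hc : 3 ≤ Nat.card (stabilizer G c)) (hindex : (stabilizer G c).index = 2) :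
    (stabilizer G c).Characteristic := by
  have hnormal := Subgroup.normal_of_index_eq_two hindex
  obtain ⟨⟨g, hg⟩, hgen⟩ := h.isCyclic_stabilizer hu
  have horder : orderOf g = Nat.card (stabilizer G c) := by
    rw [← orderOf_eq_card_of_forall_mem_zpowers hgen, Subgroup.orderOf_mk]
  rw [Subgroup.characteristic_iff_map_le]
  intro φ
  have hφg : φ g ∈ stabilizer G c := by
    have hφorder : orderOf (φ g) = Nat.card (stabilizer G c) := by
      rw [← horder]; exact φ.orderOf_eq g
    obtain ⟨z, hz⟩ := h.exists_fixed (φ g)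
    have hdvd : Nat.card (stabilizer G c) ∣ Nat.card (stabilizer G z) := by
      rw [← hφorder]
      exact (stabilizer G z).orderOf_dvd_natCard hz
    have hz1 : stabilizer G z ≠ ⊥ := stabilizer_ne_bot_of_fixed (fun h1 => by
      rw [h1, orderOf_one] at hφorder; omega) hz
    obtain hmem | hmem | ⟨k, rfl⟩ := hall z hz1
    · rw [card_stabilizer_of_mem_orbit hmem, ha] at hdvd
      exact absurd (Nat.le_of_dvd (by norm_num) hdvd) (by omega)
    · rw [card_stabilizer_of_mem_orbit hmem, hb] at hdvd
      exact absurd (Nat.le_of_dvd (by norm_num) hdvd) (by omega)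
    · have hk : k⁻¹ * φ g * k ∈ stabilizer G c := by
        rw [mem_stabilizer_iff, mul_smul, mul_smul, inv_smul_eq_iff]
        exact hz
      have := hnormal.conj_mem _ hk k
      simpa [mul_assoc] using this
  rintro _ ⟨k, hk, rfl⟩
  obtain ⟨n, hn⟩ := Subgroup.mem_zpowers_iff.mp (hgen ⟨k, hk⟩)
  have hn' : g ^ n = k := by simpa using congrArg Subtype.val hn
  change φ k ∈ _
  rw [← hn', map_zpow]
  exact (stabilizer G c).zpow_mem hφg n

theorem isKleinFour_of_card (h : IsProjectiveLineAction p K G X) (hcard : Nat.card G = 4)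
    (hall : ∀ y : X, stabilizer G y ≠ ⊥ → Nat.card (stabilizer G y) = 2) : IsKleinFour G := by
  refine ⟨hcard, Nat.dvd_antisymm (Monoid.exponent_dvd_of_forall_pow_eq_one fun g => ?_) ?_⟩
  · by_cases hg1 : g = 1
    · rw [hg1, one_pow]
    · obtain ⟨y, hy⟩ := h.exists_fixed g
      have := (stabilizer G y).orderOf_dvd_natCard hy
      rw [hall y (stabilizer_ne_bot_of_fixed hg1 hy)] at this
      exact orderOf_dvd_iff_pow_eq_one.mp this
  · obtain ⟨g, hg⟩ := exists_prime_orderOf_dvd_card' (G := G) 2 (by rw [hcard]; norm_num)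
    rw [← hg]
    exact Monoid.order_dvd_exponent g

/-- The group acts faithfully on the four points of the orbit of `b`, with image of index 2 in the
symmetric group. -/
theorem nonempty_mulEquiv_alternatingGroup (h : IsProjectiveLineAction p K G X) {b : X}
    (hcard : Nat.card G = 12) (hb : Nat.card (stabilizer G b) = 3) :
    Nonempty (G ≃* alternatingGroup (Fin 4)) := by
  classical
  have hindex : (stabilizer G b).index = 4 := by
    have := (stabilizer G b).card_mul_index
    rw [hb, hcard] at this
    omega
  have hfin : (orbit G b).Finite := Set.finite_range _
  have := hfin.fintype
  have horb : Nat.card (orbit G b) = 4 := by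
    rw [← hindex, index_stabilizer]; rfl
  let φ := toPermHom G (orbit G b)
  have hφ : Function.Injective φ := by
    rw [injective_iff_map_eq_one]
    intro g hg
    refine h.eq_one_of_forall_mem_orbit (x := b) (by omega) fun y hy => ?_
    exact congrArg Subtype.val (Equiv.congr_fun hg (⟨y, hy⟩ : orbit G b))
  have hrange : φ.range = alternatingGroup (orbit G b) := by
    refine Equiv.Perm.eq_alternatingGroup_of_index_eq_two ?_
    have h1 := φ.range.card_mul_index
    have h2 : Nat.card φ.range = 12 := by
      rw [← hcard]
      exact (Nat.card_congr (φ.ofInjective hφ).toEquiv).symm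
    rw [h2, Nat.card_perm, horb, show Nat.factorial 4 = 24 from rfl] at h1
    omega
  have e : orbit G b ≃ Fin 4 := by
    refine Fintype.equivFinOfCardEq ?_
    rw [← Nat.card_eq_fintype_card, horb]
  exact ⟨(φ.ofInjective hφ).trans ((MulEquiv.subgroupCongr hrange).trans (Equiv.altCongrHom e))⟩

/-- The action on the four Sylow 3-subgroups is faithful, hence bijective by orders. These subgroups
are the stabilizers of the eight points in the orbit of `b`. -/
theorem nonempty_mulEquiv_perm (h : IsProjectiveLineAction p K G X) {b : X}
    (hcard : Nat.card G = 24) (hb : Nat.card (stabilizer G b) = 3)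
    (hall : ∀ y : X, 3 ∣ Nat.card (stabilizer G y) → Nat.card (stabilizer G y) = 3) :
    Nonempty (G ≃* Equiv.Perm (Fin 4)) := by
  classical
  have hindex : (stabilizer G b).index = 8 := by
    have := (stabilizer G b).card_mul_index
    rw [hb, hcard] at this
    omega
  have hstab3 : ∀ y ∈ orbit G b, Nat.card (stabilizer G y) = 3 := fun y hy =>
    (card_stabilizer_of_mem_orbit hy).trans hb
  have hSyl : ∀ y ∈ orbit G b, ∃ P : Sylow 3 G, (P : Subgroup G) = stabilizer G y := by
    intro y hy
    have hdvd : ¬ 3 ∣ (stabilizer G y).index := by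
      have := (stabilizer G y).card_mul_index
      rw [hstab3 y hy, hcard] at this
      omega
    exact ⟨(IsPGroup.of_card (n := 1) (hstab3 y hy)).toSylow hdvd, rfl⟩
  have hgen : ∀ y ∈ orbit G b, ∃ c : G, c • y = y ∧ c ≠ 1 ∧ ∀ g ∈ stabilizer G y, g ^ 3 = 1 := by
    intro y hy
    obtain ⟨c, hc, hc1⟩ := (Subgroup.bot_or_exists_ne_one (stabilizer G y)).resolve_left fun hbot => by
      have := hstab3 y hy
      rw [hbot, Subgroup.card_bot] at this
      omega
    refine ⟨c, hc, hc1, fun g hg => orderOf_dvd_iff_pow_eq_one.mp ?_⟩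
    rw [← hstab3 y hy]
    exact (stabilizer G y).orderOf_dvd_natCard hg
  have hbmem : b ∈ orbit G b := mem_orbit_self b
  obtain ⟨c, hcb, hc1, hpow3⟩ := hgen b hbmem
  obtain ⟨P, hP⟩ := hSyl b hbmem
  have hnum : Nat.card (Sylow 3 G) = 4 := by
    have h1 : Nat.card (Sylow 3 G) ∣ 8 := by
      rw [← hindex, ← hP]; exact P.card_dvd_index
    have h2 : Nat.card (Sylow 3 G) % 3 = 1 := card_sylow_modEq_one 3 G
    -- A unique Sylow subgroup would fix all eight points of the orbit.
    have h3 : Nat.card (Sylow 3 G) ≠ 1 := fun hone => by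
      have := (Nat.card_eq_one_iff_unique.mp hone).1
      refine hc1 (h.eq_one_of_forall_mem_orbit (x := b) (by omega) fun y hy => ?_)
      obtain ⟨Q, hQ⟩ := hSyl y hy
      change c ∈ stabilizer G y
      rw [← hQ, Subsingleton.elim Q P, hP]
      exact hcb
    have h4 := Nat.le_of_dvd (by norm_num) h1
    interval_cases Nat.card (Sylow 3 G) <;> omega
  let φ := toPermHom G (Sylow 3 G)
  have hker : ∀ g ∈ φ.ker, ∀ y ∈ orbit G b, stabilizer G (g • y) = stabilizer G y := by
    intro g hg y hy
    obtain ⟨Q, hQ⟩ := hSyl y hy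
    have h1 : g • Q = Q := Equiv.congr_fun (MonoidHom.mem_ker.mp hg) Q
    have h2 := congrArg (fun S : Sylow 3 G => (S : Subgroup G)) h1
    rw [stabilizer_smul_eq_stabilizer_map_conj, ← hQ]
    exact h2
  -- A generator `d` of the stabilizer of `y` also fixes `g • y` and `g • g • y`, so these three
  -- points cannot be distinct.
  have hsq : ∀ g ∈ φ.ker, g ^ 2 = 1 := by
    intro g hg
    refine h.eq_one_of_forall_mem_orbit (x := b) (by omega) fun y hy => ?_
    obtain ⟨d, hdy, hd1, -⟩ := hgen y hy
    have e1 := hker g hg y hy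
    have e2 := hker g hg (g • y) (mem_orbit_of_mem_orbit g hy)
    have hd2 : d • g • y = g • y := by rw [← mem_stabilizer_iff, e1]; exact hdy
    have hd3 : d • g • g • y = g • g • y := by rw [← mem_stabilizer_iff, e2, e1]; exact hdy
    by_contra hne
    rw [pow_two, mul_smul] at hne
    have hy1 : g • y ≠ y := fun heq => hne (by rw [heq, heq])
    exact hd1 (h.eq_one_of_three_fixed (x := y) (y := g • y) (z := g • g • y) hy1.symm
      (fun heq => hne heq.symm) (fun heq => hy1 (smul_left_cancel g heq.symm)) hdy hd2 hd3)
  have hφ : Function.Injective φ := by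
    rw [← MonoidHom.ker_eq_bot_iff, eq_bot_iff]
    intro g hg
    rw [Subgroup.mem_bot]
    by_contra hg1
    have hg2 := hsq g hg
    -- The commutator lies in the kernel, so its square is trivial, and in the stabilizer of `b`, so
    -- its cube is trivial.
    have hk : c * g * c⁻¹ * g⁻¹ = 1 := by
      have hker2 : (c * g * c⁻¹ * g⁻¹) ^ 2 = 1 := hsq _ <|
        φ.ker.mul_mem ((inferInstance : φ.ker.Normal).conj_mem g hg c) (φ.ker.inv_mem hg)
      have hker3 : (c * g * c⁻¹ * g⁻¹) ^ 3 = 1 := by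
        refine hpow3 _ ?_
        have hcinv : c⁻¹ ∈ stabilizer G (g⁻¹ • b) := by
          rw [hker g⁻¹ (φ.ker.inv_mem hg) b hbmem]
          exact (stabilizer G b).inv_mem hcb
        have hcinv' : c⁻¹ • g⁻¹ • b = g⁻¹ • b := hcinv
        rw [mem_stabilizer_iff, mul_smul, mul_smul, mul_smul, hcinv', smul_inv_smul]
        exact hcb
      rwa [pow_succ, hker2, one_mul] at hker3
    have hcomm : c * g = g * c := by
      rwa [mul_inv_eq_one, mul_inv_eq_iff_eq_mul] at hk
    have hc3 : c ^ 3 = 1 := hpow3 c hcb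
    obtain ⟨z, hz⟩ := h.exists_fixed g
    have hz1 : g • c • z = c • z := by rw [← mul_smul, ← hcomm, mul_smul, hz]
    have hz2 : g • c • c • z = c • c • z := by rw [← mul_smul, ← hcomm, mul_smul, hz1]
    -- `c` has order 3 and permutes the fixed points of `g`, of which there are at most two.
    have hcz : c • z = z := by
      by_contra hne
      refine hg1 (h.eq_one_of_three_fixed (fun heq => hne heq.symm) (fun heq => hne ?_)
        (fun heq => hne (smul_left_cancel c heq.symm)) hz hz1 hz2)
      have : c • c • c • z = z := by rw [← mul_smul, ← mul_smul, ← pow_three', hc3, one_smul]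
      rwa [← heq] at this
    have hz3 := hall z (by
      have h1 := (stabilizer G z).orderOf_dvd_natCard hcz
      rwa [orderOf_eq_prime hc3 hc1] at h1)
    have hg3 : g ^ 3 = 1 := by
      rw [← orderOf_dvd_iff_pow_eq_one, ← hz3]
      exact (stabilizer G z).orderOf_dvd_natCard hz
    rw [pow_succ, hg2, one_mul] at hg3
    exact hg1 hg3
  have e : Sylow 3 G ≃ Fin 4 := by
    have := Fintype.ofFinite (Sylow 3 G)
    refine Fintype.equivFinOfCardEq ?_
    rw [← Nat.card_eq_fintype_card, hnum]
  have hbij : Function.Bijective φ := by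
    rw [Nat.bijective_iff_injective_and_card]
    exact ⟨hφ, by rw [Nat.card_perm, hnum, hcard]; rfl⟩
  exact ⟨(MulEquiv.ofBijective φ hbij).trans e.permCongrHom⟩

theorem classification_of_not_dvd (h : IsProjectiveLineAction p K G X) [hp : Fact p.Prime]
    (hndvd : ¬ p ∣ Nat.card G) :
    IsCyclic G ∨ (∃ C : Subgroup G, C.Characteristic ∧ IsCyclic C ∧ C.index = 2) ∨
      IsKleinFour G ∨ Nonempty (G ≃* alternatingGroup (Fin 4)) ∨
      Nonempty (G ≃* Equiv.Perm (Fin 4)) ∨ Nat.card G = 60 := by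
  have hu : ∀ x, h.unipotentSubgroup x = ⊥ := fun x => by
    by_contra hne
    have hpu : p ∣ Nat.card (h.unipotentSubgroup x) :=
      (h.isPGroup_unipotentSubgroup x).card_eq_or_dvd.resolve_left
        ((Subgroup.one_lt_card_iff_ne_bot _).mpr hne).ne'
    exact hndvd (hpu.trans (Subgroup.card_subgroup_dvd_card _))
  obtain ⟨x, hx⟩ | ⟨a, b, c, hall, hcases⟩ := h.exists_signature hu
  · left
    have := h.isCyclic_stabilizer (hu x)
    rw [hx] at this
    exact Subgroup.topEquiv.isCyclic.mp this
  · right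
    have hall' : ∀ y, stabilizer G y ≠ ⊥ →
        Nat.card (stabilizer G y) = Nat.card (stabilizer G a) ∨
        Nat.card (stabilizer G y) = Nat.card (stabilizer G b) ∨
        Nat.card (stabilizer G y) = Nat.card (stabilizer G c) := fun y hy =>
      (hall y hy).imp card_stabilizer_of_mem_orbit
        (Or.imp card_stabilizer_of_mem_orbit card_stabilizer_of_mem_orbit)
    obtain ⟨ha, hb, hN, hc⟩ | ⟨ha, hb, hc, hN⟩ | ⟨ha, hb, hc, hN⟩ | hN := hcases
    · obtain hc2 | hc3 : Nat.card (stabilizer G c) = 2 ∨ 3 ≤ Nat.card (stabilizer G c) := by omega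
      · refine Or.inr (Or.inl (h.isKleinFour_of_card (by omega) fun y hy => ?_))
        have := hall' y hy
        omega
      · have hindex : (stabilizer G c).index = 2 := by
          have := (stabilizer G c).card_mul_index
          exact Nat.eq_of_mul_eq_mul_left (by omega) (this.trans (by rw [hN, mul_comm]))
        exact Or.inl ⟨stabilizer G c, h.characteristic_stabilizer_of_index_two (hu c) hall ha hb hc3
          hindex, h.isCyclic_stabilizer (hu c), hindex⟩
    · exact Or.inr (Or.inr (Or.inl (h.nonempty_mulEquiv_alternatingGroup hN hb)))
    · refine Or.inr (Or.inr (Or.inr (Or.inl (h.nonempty_mulEquiv_perm hN hb fun y hy => ?_))))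
      have := hall' y fun hbot => by
        rw [hbot, Subgroup.card_bot] at hy; omega
      omega
    · exact Or.inr (Or.inr (Or.inr (Or.inr hN)))

end IsProjectiveLineAction

/-! ### Characteristic subgroups of order four -/

theorem Subgroup.Characteristic.map_mulEquiv {G H : Type*} [Group G] [Group H] (e : G ≃* H)
    {A : Subgroup G} (hA : A.Characteristic) : (A.map e.toMonoidHom).Characteristic := by
  rw [Subgroup.characteristic_iff_map_le] at hA ⊢
  rintro φ _ ⟨_, ⟨a, ha, rfl⟩, rfl⟩
  have h := hA ((e.trans φ).trans e.symm) ⟨a, ha, rfl⟩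
  exact ⟨e.symm (φ (e a)), h, e.apply_symm_apply _⟩

/-- `G` has a characteristic abelian subgroup of order `4` and index at most `6`. -/
def HasCharAbelianSubgroupOfCardFour (G : Type*) [Group G] : Prop :=
  ∃ A : Subgroup G, A.Characteristic ∧ IsMulCommutative A ∧ Nat.card A = 4 ∧ A.index ≤ 6

theorem isMulCommutative_of_card_four {G : Type*} [Group G] (h : Nat.card G = 2 ^ 2) :
    IsMulCommutative G :=
  IsPGroup.isMulCommutative_of_card_eq_prime_sq h

theorem HasCharAbelianSubgroupOfCardFour.of_card {G : Type*} [Group G] [Finite G] {A : Subgroup G}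
    (hA : A.Characteristic) (hcard : Nat.card A = 4) (hG : Nat.card G ≤ 24) :
    HasCharAbelianSubgroupOfCardFour G := by
  refine ⟨A, hA, isMulCommutative_of_card_four hcard, hcard, ?_⟩
  have := A.card_mul_index
  rw [hcard] at this
  omega

theorem HasCharAbelianSubgroupOfCardFour.of_mulEquiv {G H : Type*} [Group G] [Group H] [Finite H]
    (e : G ≃* H) (hH : Nat.card H ≤ 24) (h : HasCharAbelianSubgroupOfCardFour G) :
    HasCharAbelianSubgroupOfCardFour H := by
  obtain ⟨A, hA, -, hcard, -⟩ := h
  refine .of_card (hA.map_mulEquiv e) ?_ hH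
  rw [← hcard]
  exact (Nat.card_congr (e.subgroupMap A).toEquiv).symm

theorem hasCharAbelianSubgroupOfCardFour_alternatingGroup :
    HasCharAbelianSubgroupOfCardFour (alternatingGroup (Fin 4)) := by
  have h4 : Nat.card (Fin 4) = 4 := Nat.card_fin 4
  refine .of_card (alternatingGroup.characteristic_kleinFour h4)
    (alternatingGroup.kleinFour_card_of_card_eq_four h4) ?_
  rw [alternatingGroup.card_of_card_eq_four h4]
  norm_num

theorem hasCharAbelianSubgroupOfCardFour_perm :
    HasCharAbelianSubgroupOfCardFour (Equiv.Perm (Fin 4)) := by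
  have h4 : Nat.card (Fin 4) = 4 := Nat.card_fin 4
  have := alternatingGroup.characteristic_kleinFour h4
  refine .of_card (A := (alternatingGroup.kleinFour (Fin 4)).map (alternatingGroup (Fin 4)).subtype)
    inferInstance ?_ ?_
  · rw [Subgroup.card_map_of_injective (Subgroup.subtype_injective _)]
    exact alternatingGroup.kleinFour_card_of_card_eq_four h4
  · rw [Nat.card_perm, h4]; rfl

theorem Nat.card_perm_fin_four : Nat.card (Equiv.Perm (Fin 4)) = 24 := by
  rw [Nat.card_perm, Nat.card_fin]; rfl

theorem IsoMuTwoSq.card_eq {G : Type*} [Group G] (h : IsoMuTwoSq G) : Nat.card G = 4 := by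
  obtain ⟨e⟩ := h
  rw [Nat.card_congr e.toEquiv, Nat.card_prod, Nat.card_eq_fintype_card, Fintype.card_multiplicative,
    ZMod.card]

theorem IsoMuTwoSq.of_isKleinFour {G : Type*} [Group G] [IsKleinFour G] : IsoMuTwoSq G := by
  have : IsKleinFour (Multiplicative (ZMod 2) × Multiplicative (ZMod 2)) := by
    refine ⟨by simp [Nat.card_eq_fintype_card], ?_⟩
    rw [Monoid.exponent_prod, Monoid.exponent_multiplicative, ZMod.exponent]
    rfl
  exact IsKleinFour.nonempty_mulEquiv

theorem IsoSymAltFourOrMuTwoSq.card_eq {G : Type*} [Group G] (h : IsoSymAltFourOrMuTwoSq G) :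
    Nat.card G = 24 ∨ Nat.card G = 12 ∨ Nat.card G = 4 := by
  obtain ⟨⟨e⟩⟩ | ⟨⟨e⟩⟩ | h := h
  · exact Or.inl ((Nat.card_congr e.toEquiv).trans Nat.card_perm_fin_four)
  · exact Or.inr (Or.inl ((Nat.card_congr e.toEquiv).trans
      (alternatingGroup.card_of_card_eq_four (Nat.card_fin 4))))
  · exact Or.inr (Or.inr h.card_eq)

theorem IsoSymAltFourOrMuTwoSq.hasCharAbelianSubgroupOfCardFour {G : Type*} [Group G] [Finite G]
    (h : IsoSymAltFourOrMuTwoSq G) : HasCharAbelianSubgroupOfCardFour G := by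
  have hcard : Nat.card G ≤ 24 := by have := h.card_eq; omega
  obtain ⟨⟨e⟩⟩ | ⟨⟨e⟩⟩ | h := h
  · exact hasCharAbelianSubgroupOfCardFour_perm.of_mulEquiv e.symm hcard
  · exact hasCharAbelianSubgroupOfCardFour_alternatingGroup.of_mulEquiv e.symm hcard
  · refine .of_card (A := ⊤) inferInstance ?_ hcard
    rw [Subgroup.card_top, h.card_eq]

/-! ### Assembling the bounds -/

theorem HasCharCyclicSubgroupOfBound.mono {p : ℕ} {G : Type*} [Group G] {J J' : ℚ} (hJ : J ≤ J')
    (h : HasCharCyclicSubgroupOfBound p G J) : HasCharCyclicSubgroupOfBound p G J' := by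
  obtain ⟨C, h1, h2, h3, h4⟩ := h
  exact ⟨C, h1, h2, h3, fun P => (h4 P).trans (by gcongr)⟩

theorem HasCharCyclicSubgroupOfBound.of_card_le {p : ℕ} {G : Type*} [Group G] {J : ℚ}
    (h : ∀ P : Sylow p G, (Nat.card G : ℚ) ≤ J * (Nat.card P : ℚ) ^ 3) :
    HasCharCyclicSubgroupOfBound p G J :=
  ⟨⊥, inferInstance, inferInstance, by simp, fun P => by rw [Subgroup.index_bot]; exact h P⟩

theorem HasCharCyclicSubgroupOfBound.of_index_le {p : ℕ} {G : Type*} [Group G] [Finite G] {J : ℚ}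
    (hJ : 0 ≤ J) {C : Subgroup G} (h1 : C.Characteristic) (h2 : IsCyclic C)
    (h3 : (Nat.card C).Coprime p) (h : (C.index : ℚ) ≤ J) :
    HasCharCyclicSubgroupOfBound p G J := by
  refine ⟨C, h1, h2, h3, fun P => h.trans (le_mul_of_one_le_right hJ (one_le_pow₀ ?_))⟩
  exact_mod_cast Nat.card_pos (α := P)

theorem HasCharCyclicSubgroupOfBound.of_card_group_le {p : ℕ} {G : Type*} [Group G] [Finite G]
    {J : ℚ} (hJ : 0 ≤ J) (h : (Nat.card G : ℚ) ≤ J) : HasCharCyclicSubgroupOfBound p G J :=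
  .of_index_le hJ (C := ⊥) inferInstance inferInstance (by simp) (by rwa [Subgroup.index_bot])

section

variable {k : Type*} [Field k] {p : ℕ} [CharP k p] [hp : Fact p.Prime]
  (G : Subgroup (Matrix.ProjGenLinGroup (Fin 2) k)) [Finite G]

theorem hasCharCyclicSubgroupOfBound_of_dvd (hdvd : p ∣ Nat.card G) :
    HasCharCyclicSubgroupOfBound p G (if p = 3 then 20 / 9 else 1) := by
  obtain ⟨_, h⟩ := exists_isProjectiveLineAction p G
  have : CharP (AlgebraicClosure k) p :=
    charP_of_injective_algebraMap (algebraMap k (AlgebraicClosure k)).injective p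
  have hJ : (1 : ℚ) ≤ if p = 3 then 20 / 9 else 1 := by split_ifs <;> norm_num
  obtain ⟨P⟩ := (inferInstance : Nonempty (Sylow p G))
  have hP : ∀ Q : Sylow p G, Nat.card Q = Nat.card P := fun Q => Nat.card_congr (Q.equiv P).toEquiv
  obtain h1 | ⟨rfl, h2, h3⟩ | ⟨C, hC1, hC2, hC3, hC4⟩ := h.card_bound_of_dvd hdvd P
  · refine HasCharCyclicSubgroupOfBound.mono hJ (.of_card_le fun Q => ?_)
    rw [hP Q, one_mul]
    exact_mod_cast h1
  -- The trivial subgroup attains equality: `60 = 20 / 9 * 3 ^ 3`.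
  · refine .of_card_le fun Q => ?_
    rw [hP Q, h2, h3]
    norm_num
  · refine HasCharCyclicSubgroupOfBound.mono hJ ⟨C, hC1, hC2, hC3, fun Q => ?_⟩
    have h2 : 2 ≤ Nat.card Q := hp.out.two_le.trans (Nat.le_of_dvd Nat.card_pos
      (Q.dvd_card_of_dvd_card hdvd))
    have h3 : (2 : ℚ) ≤ Nat.card Q := by exact_mod_cast h2
    rw [hC4, one_mul]
    calc ((2 : ℕ) : ℚ) ≤ (Nat.card Q : ℚ) ^ 1 := by rw [pow_one]; exact_mod_cast h2
      _ ≤ (Nat.card Q : ℚ) ^ 3 := pow_le_pow_right₀ (by linarith) (by norm_num)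

/-- The divisibilities by 2 and 3 are recorded so that the corresponding cases drop out in those
characteristics. -/
theorem hasCharCyclicSubgroupOfBound_or_of_not_dvd (hndvd : ¬ p ∣ Nat.card G) :
    HasCharCyclicSubgroupOfBound p G 1 ∨
      (2 ∣ Nat.card G ∧ HasCharCyclicSubgroupOfBound p G 2) ∨ IsoMuTwoSq G ∨
      (3 ∣ Nat.card G ∧ IsoSymAltFourOrMuTwoSq G) ∨ Nat.card G = 60 := by
  obtain ⟨_, h⟩ := exists_isProjectiveLineAction p G
  have hcop : ∀ C : Subgroup G, (Nat.card C).Coprime p := fun C =>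
    Nat.coprime_comm.mp ((hp.out.coprime_iff_not_dvd).mpr fun hC =>
      hndvd (hC.trans C.card_subgroup_dvd_card))
  obtain h1 | ⟨C, hC1, hC2, hC3⟩ | h1 | ⟨⟨e⟩⟩ | ⟨⟨e⟩⟩ | h1 := h.classification_of_not_dvd hndvd
  · exact Or.inl (.of_index_le zero_le_one (C := ⊤) inferInstance
      (Subgroup.topEquiv.isCyclic.mpr h1) (hcop _) (by simp))
  · exact Or.inr (Or.inl ⟨(dvd_of_eq hC3.symm).trans C.index_dvd_card,
      .of_index_le zero_le_two hC1 hC2 (hcop C) (by rw [hC3]; norm_num)⟩)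
  · exact Or.inr (Or.inr (Or.inl .of_isKleinFour))
  · refine Or.inr (Or.inr (Or.inr (Or.inl ⟨?_, Or.inr (Or.inl ⟨e⟩)⟩)))
    rw [Nat.card_congr e.toEquiv, alternatingGroup.card_of_card_eq_four (Nat.card_fin 4)]
    norm_num
  · refine Or.inr (Or.inr (Or.inr (Or.inl ⟨?_, Or.inl ⟨e⟩⟩)))
    rw [Nat.card_congr e.toEquiv, Nat.card_perm_fin_four]
    norm_num
  · exact Or.inr (Or.inr (Or.inr (Or.inr h1)))

theorem hasCharCyclicSubgroupOfBound_sixty : HasCharCyclicSubgroupOfBound p G 60 := by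
  by_cases hdvd : p ∣ Nat.card G
  · exact (hasCharCyclicSubgroupOfBound_of_dvd G hdvd).mono (by split_ifs <;> norm_num)
  obtain h | ⟨-, h⟩ | h | ⟨-, h⟩ | h := hasCharCyclicSubgroupOfBound_or_of_not_dvd G hdvd
  · exact h.mono (by norm_num)
  · exact h.mono (by norm_num)
  · refine HasCharCyclicSubgroupOfBound.of_card_group_le (by norm_num) ?_
    rw [h.card_eq]; norm_num
  · refine HasCharCyclicSubgroupOfBound.of_card_group_le (by norm_num) ?_
    have : Nat.card G ≤ 60 := by have := h.card_eq; omega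
    exact_mod_cast this
  · refine HasCharCyclicSubgroupOfBound.of_card_group_le (by norm_num) ?_
    rw [h]; norm_num

end

theorem hasCharCyclicSubgroupOfBound_two {k : Type*} [Field k] [CharP k 2]
    (G : Subgroup (Matrix.ProjGenLinGroup (Fin 2) k)) [Finite G] :
    HasCharCyclicSubgroupOfBound 2 G 1 := by
  by_cases hdvd : 2 ∣ Nat.card G
  · simpa using hasCharCyclicSubgroupOfBound_of_dvd G hdvd
  obtain h | ⟨h, -⟩ | h | ⟨-, h⟩ | h := hasCharCyclicSubgroupOfBound_or_of_not_dvd G hdvd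
  · exact h
  · exact absurd h hdvd
  · have := h.card_eq; omega
  · have := h.card_eq; omega
  · omega

theorem hasCharCyclicSubgroupOfBound_three {k : Type*} [Field k] [CharP k 3]
    (G : Subgroup (Matrix.ProjGenLinGroup (Fin 2) k)) [Finite G] (hG : ¬ IsoMuTwoSq G) :
    HasCharCyclicSubgroupOfBound 3 G (20 / 9) := by
  by_cases hdvd : 3 ∣ Nat.card G
  · simpa using hasCharCyclicSubgroupOfBound_of_dvd G hdvd
  obtain h | ⟨-, h⟩ | h | ⟨h, -⟩ | h := hasCharCyclicSubgroupOfBound_or_of_not_dvd G hdvd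
  · exact h.mono (by norm_num)
  · exact h.mono (by norm_num)
  · exact absurd h hG
  · exact absurd h hdvd
  · omega

theorem hasCharCyclicSubgroupOfBound_five {k : Type*} [Field k] [CharP k 5]
    (G : Subgroup (Matrix.ProjGenLinGroup (Fin 2) k)) [Finite G]
    (hG : ¬ IsoSymAltFourOrMuTwoSq G) : HasCharCyclicSubgroupOfBound 5 G 2 := by
  have : Fact (Nat.Prime 5) := ⟨by norm_num⟩
  by_cases hdvd : 5 ∣ Nat.card G
  · exact (hasCharCyclicSubgroupOfBound_of_dvd G hdvd).mono (by norm_num)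
  obtain h | ⟨-, h⟩ | h | ⟨-, h⟩ | h := hasCharCyclicSubgroupOfBound_or_of_not_dvd G hdvd
  · exact h.mono (by norm_num)
  · exact h
  · exact absurd (Or.inr (Or.inr h)) hG
  · exact absurd h hG
  · omega

theorem lemma7p3 {k : Type*} [Field k] (p : ℕ) [CharP k p] (hp : 0 < p)
    (G : Subgroup (Matrix.ProjGenLinGroup (Fin 2) k)) [Finite G] :
    HasCharCyclicSubgroupOfBound p G (jordanConstP1 p) ∧
    (p = 5 →
      (¬ IsoSymAltFourOrMuTwoSq G → HasCharCyclicSubgroupOfBound p G 2) ∧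
      (IsoSymAltFourOrMuTwoSq G →
        (∃ A : Subgroup G, A.Characteristic ∧ IsMulCommutative A ∧ Nat.card A = 4 ∧
          A.index ≤ 6) ∧
        ∀ P : Sylow p G, 6 * Nat.card P ^ 3 = 6)) ∧
    (p = 3 →
      (¬ IsoMuTwoSq G → HasCharCyclicSubgroupOfBound p G (20 / 9)) ∧
      (IsoMuTwoSq G → IsMulCommutative G)) := by
  have hprime : Fact p.Prime := ⟨(CharP.char_is_prime_or_zero k p).resolve_right hp.ne'⟩
  refine ⟨?_, ?_, ?_⟩
  · obtain h7 | rfl | rfl | rfl : 7 ≤ p ∨ p = 5 ∨ p = 3 ∨ p = 2 := by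
      have h2 := hprime.out.two_le
      by_contra! hne
      obtain rfl | rfl : p = 4 ∨ p = 6 := by omega
      · exact absurd hprime.out (by norm_num)
      · exact absurd hprime.out (by norm_num)
    · rw [jordanConstP1, if_pos h7]
      exact hasCharCyclicSubgroupOfBound_sixty G
    · rw [show jordanConstP1 5 = 24 by norm_num [jordanConstP1]]
      by_cases hG : IsoSymAltFourOrMuTwoSq G
      · refine HasCharCyclicSubgroupOfBound.of_card_group_le (by norm_num) ?_
        have : Nat.card G ≤ 24 := by have := hG.card_eq; omega
        exact_mod_cast this
      · exact (hasCharCyclicSubgroupOfBound_five G hG).mono (by norm_num)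
    · rw [show jordanConstP1 3 = 4 by norm_num [jordanConstP1]]
      by_cases hG : IsoMuTwoSq G
      · refine HasCharCyclicSubgroupOfBound.of_card_group_le (by norm_num) ?_
        rw [hG.card_eq]; norm_num
      · exact (hasCharCyclicSubgroupOfBound_three G hG).mono (by norm_num)
    · rw [show jordanConstP1 2 = 1 by norm_num [jordanConstP1]]
      exact hasCharCyclicSubgroupOfBound_two G
  · rintro rfl
    refine ⟨hasCharCyclicSubgroupOfBound_five G, fun hG =>
      ⟨hG.hasCharAbelianSubgroupOfCardFour, fun P => ?_⟩⟩
    -- The possible orders 24, 12 and 4 are prime to 5.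
    have h1 : Nat.card P = 1 := by
      by_contra hne
      have hdvd : 5 ∣ Nat.card G := (P.isPGroup'.card_eq_or_dvd.resolve_left hne).trans
        P.card_subgroup_dvd_card
      have := hG.card_eq
      omega
    rw [h1]
    norm_num
  · rintro rfl
    exact ⟨hasCharCyclicSubgroupOfBound_three G, fun hG =>
      isMulCommutative_of_card_four hG.card_eq⟩
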